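/- Let $T\subset\mathbb{R}^2$ be the triangle with vertices $(0,0)$, $(1,0)$, $(0,1)$. For $n\ge 2$ let $T_n$ be the convex hull of $(1,0)$, $(0,1)$ and $n$ independent random points distributed uniformly in $T$, let $p_k^{(n)}$ be the probability that $T_n$ has exactly $k+2$ vertices, and put $G_n(z)=\sum_{k=1}^n p_k^{(n)}z^k$; put also $G_0(z)=1$ and $G_1(z)=z$. Let $F(u,z)=\sum_{n\ge 0}G_n(z)u^n$. Consider the differential equation with initial conditions $$F_{uu}+\frac{2}{u}F_u-\frac{2z}{u(u-1)^2}F=0,\qquad F(0,z)=1,\quad F_u(0,z)=z. \tag{$*$}$$ Then: 1. As an element of $\mathbb{C}[[u,z]]$, $F$ is the unique formal power series that satisfies $(*)$ (with denominators cleared). 2. For every $z\in\mathbb{C}$ and every $u\in\mathbb{C}$ with $|u|<1$, the series converges and $$F(u,z)=\frac{{}_2F_1(1-\alpha,-\alpha;2;u)}{(1-u)^{\alpha}},\qquad \alpha=\alpha(z)=\frac{\sqrt{8z+1}-1}{2},$$ where ${}_2F_1(a,b;c;u)=\sum_{n\ge0}\frac{a(a+1)\cdots(a+n-1)\;b(b+1)\cdots(b+n-1)}{c(c+1)\cdots(c+n-1)}\frac{u^n}{n!}$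 is the Gaussian hypergeometric function and the square root and the power are principal values. For every fixed $z\in\mathbb{C}$ this function of $u$ is a holomorphic solution of $(*)$ on $\{|u|<1\}$, and every holomorphic solution of $(*)$ on a disc $\{|u|<r\}$ with $0<r\le 1$ coincides with it there (the equation being required for $u\neq 0$). 3. The function $F$ extends uniquely to a jointly analytic function on $\{(u,z)\in\mathbb{C}^2: u\notin[1,\infty),\ z\notin(-\infty,-1/8]\}$, and for each $z\notin(-\infty,-1/8]$ this extension solves $(*)$ in $u$ on $\mathbb{C}\setminus[1,\infty)$. -/

import Mathlib

open MeasureTheory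
open scoped PowerSeries Polynomial

namespace ConvexChain

noncomputable section

/-- The triangle with vertices `(0,0)`, `(1,0)`, `(0,1)`. -/
def triangle : Set (ℝ × ℝ) :=
  convexHull ℝ {((0 : ℝ), (0 : ℝ)), ((1 : ℝ), (0 : ℝ)), ((0 : ℝ), (1 : ℝ))}

/-- The uniform distribution on the triangle (normalized Lebesgue measure). -/
def uniformTriangle : Measure (ℝ × ℝ) :=
  ProbabilityTheory.cond volume triangle

/-- The convex hull of `(1,0)`, `(0,1)` and the points `x 0, …, x (n - 1)`. -/
def chainHull {n : ℕ} (x : Fin n → ℝ × ℝ) : Set (ℝ × ℝ) :=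
  convexHull ℝ ({((1 : ℝ), (0 : ℝ)), ((0 : ℝ), (1 : ℝ))} ∪ Set.range x)

/-- The number of vertices (extreme points) of the polygon `chainHull x`. -/
def vertexCount {n : ℕ} (x : Fin n → ℝ × ℝ) : ℕ :=
  ((chainHull x).extremePoints ℝ).ncard

/-- The probability that the convex hull of `(1,0)`, `(0,1)` and `n` independent uniform random
points of the triangle has exactly `k + 2` vertices. -/
def prob (n k : ℕ) : ℝ :=
  (Measure.pi (fun _ : Fin n => uniformTriangle)).real {x | vertexCount x = k + 2}

/-- The generating polynomials `G₀ = 1`, `G₁ = z` and `Gₙ = ∑_{k=1}^n p_k^{(n)} z^k` for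
`n ≥ 2`. -/
def genPoly : ℕ → ℂ[X]
  | 0 => 1
  | 1 => Polynomial.X
  | n + 2 => ∑ k ∈ Finset.Icc 1 (n + 2),
      Polynomial.C ((prob (n + 2) k : ℝ) : ℂ) * Polynomial.X ^ k

/-- The bivariate generating function `∑ₙ Gₙ(z) uⁿ` as an element of `ℂ⟦z⟧⟦u⟧ = ℂ⟦u, z⟧`
(the outer variable is `u`, the inner one is `z`). -/
def genSeries : ℂ⟦X⟧⟦X⟧ :=
  PowerSeries.mk fun n => ((genPoly n : ℂ[X]) : ℂ⟦X⟧)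

/-- `H ∈ ℂ⟦z⟧⟦u⟧` satisfies `H_uu + (2/u) H_u - 2z/(u(u-1)²) H = 0`, with the denominators
cleared, together with `H(0,z) = 1` and `H_u(0,z) = z`. -/
def IsFormalSolution (H : ℂ⟦X⟧⟦X⟧) : Prop :=
  let D : ℂ⟦X⟧⟦X⟧ → ℂ⟦X⟧⟦X⟧ := PowerSeries.derivative ℂ⟦X⟧
  let u : ℂ⟦X⟧⟦X⟧ := PowerSeries.X
  let z : ℂ⟦X⟧⟦X⟧ := PowerSeries.C (PowerSeries.X : ℂ⟦X⟧)
  u * (1 - u) ^ 2 * D (D H) + 2 * (1 - u) ^ 2 * D H - 2 * z * H = 0 ∧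
    PowerSeries.constantCoeff H = 1 ∧
    PowerSeries.constantCoeff (D H) = (PowerSeries.X : ℂ⟦X⟧)

/-- For a fixed `z`, the function `f` is holomorphic on the open set `U ∋ 0`, satisfies
`f'' + (2/u) f' - 2z/(u(u-1)²) f = 0` on `U` away from the singular points `0`, `1` of the
coefficients, and has `f(0) = 1`, `f'(0) = z`. -/
def IsSolution (z : ℂ) (U : Set ℂ) (f : ℂ → ℂ) : Prop :=
  DifferentiableOn ℂ f U ∧
    (∀ u ∈ U, u ≠ 0 → u ≠ 1 →
      deriv (deriv f) u + 2 / u * deriv f u + -(2 * z / (u * (u - 1) ^ 2)) * f u = 0) ∧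
    f 0 = 1 ∧ deriv f 0 = z

/-- `α(z) = (√(8z+1) - 1)/2`, with the principal square root. -/
def alpha (z : ℂ) : ℂ := (Complex.sqrt (8 * z + 1) - 1) / 2

/-- `₂F₁(1-α, -α; 2; u) / (1-u)^α` with `α = α(z)`, for `|u| < 1`. -/
def closedForm (u z : ℂ) : ℂ :=
  ordinaryHypergeometric (1 - alpha z) (-alpha z) (2 : ℂ) u / (1 - u) ^ alpha z

/-- The complex plane slit along `[1, ∞)`. -/
def slitU : Set ℂ := {u | ¬ ∃ x : ℝ, 1 ≤ x ∧ u = (x : ℂ)}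

/-- The complex plane slit along `(-∞, -1/8]`. -/
def slitZ : Set ℂ := {z | ¬ ∃ x : ℝ, x ≤ -1 / 8 ∧ z = (x : ℂ)}

end

end ConvexChain

/-!
A chain of `n + 1` points of the triangle is split at its first point `P`, the one whose line to
`(0,1)` meets the `x`-axis furthest to the left. Then `P` is a vertex of the hull. The other points
that lie above the line through `P` and `(1,0)` fall into the triangle `(0,1)`, `P`, `(1,0)` and are
not vertices; those below it are uniformly distributed in a triangle which an affine map carries to
the original one, with `P` going to `(0,1)`, and the vertices among them are the vertices of the
chain they form there (`hullCount_insert`, which rests on `extremePoints_insert_apex`). As ties have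
probability zero, conditioning on `P` and integrating the binomial law of the number of points below
the line (`sample_first`, `lintegral_openTriangle`) gives the recurrence
`(n + 1)(n + 2) G_{n+1} = 2 z ∑_{j ≤ n} (n - j + 1) G_j` (`genPoly_isRec`).

The weights `n + 1` are the coefficients of `1 / (1 - u)²`, so the recurrence, called `IsRec`, says
exactly that the generating series satisfies the differential equation (`formalLHS_eq_zero_iff`),
and it determines a sequence from its first term (`IsRec.unique`). The same equivalence for
convergent series (`isRec_iff_odeLHS`) reduces the statements on discs around `0` to formal ones.
The closed form has coefficients satisfying `IsRec`: with `W` the hypergeometric series and `P` that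
of `(1 - u)^(-α)`, this is a formal consequence of Gauss's equation for `W`, of `(1 - u) P' = α P`
and of `α (α + 1) = 2 z` (`closedForm_represents`). Hence it is the sum of the series and the only
holomorphic solution.

For the extension, the equation is written as the integral equation
`f(u) = 1 + 2 z u ∫₀¹ (1 - s) f(su) / (1 - su)² ds`, which makes sense on the star-shaped domain
`ℂ ∖ [1, ∞)`. Its Picard series `∑ h_k(u) zᵏ` has `‖h_k(u)‖ ≤ Cᵏ / k!` locally uniformly
(`exists_picard_bound`), so it converges for all `z`, jointly analytically
(`analyticOnNhd_tsum_mul`). Near `u = 0` it solves the differential equation, by comparison of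
coefficients, hence agrees with the closed form; that it solves the equation on the whole slit plane
and is the only extension follows from the identity theorem.
-/

namespace ConvexChain

/-! ### The differential equation for formal power series -/

/-- The power series `∑ (n + 1) Xⁿ`, the inverse of `(1 - X)²`. -/
noncomputable def invSq (R : Type*) [CommRing R] : R⟦X⟧ := PowerSeries.mk fun n => (n : R) + 1

theorem invSq_mul {R : Type*} [CommRing R] : invSq R * (1 - PowerSeries.X) ^ 2 = 1 := by
  have h := PowerSeries.mk_add_choose_mul_one_sub_pow_eq_one R 1
  have h' : invSq R = PowerSeries.mk fun n => ((1 + n).choose 1 : R) := by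
    ext n
    simp [invSq, add_comm]
  rw [h']
  exact h

/-- The recurrence satisfied by the coefficients of a solution of the differential equation after
division by `(1 - u)²`; the weights `n - j + 1` are the coefficients of `1 / (1 - u)²`. -/
def IsRec {R : Type*} [CommRing R] (z : R) (a : ℕ → R) : Prop :=
  ∀ n : ℕ, ((n : R) + 1) * ((n : R) + 2) * a (n + 1) =
    2 * z * ∑ j ∈ Finset.range (n + 1), ((n - j : ℕ) + 1 : R) * a j

/-- The left-hand side of the differential equation with denominators cleared. -/
noncomputable def formalLHS {R : Type*} [CommRing R] (z : R) (H : R⟦X⟧) : R⟦X⟧ :=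
  PowerSeries.X * (1 - PowerSeries.X) ^ 2 * d⁄dX R (d⁄dX R H)
    + 2 * (1 - PowerSeries.X) ^ 2 * d⁄dX R H - 2 * PowerSeries.C z * H

/-- The factor `(1 - X)²` is a unit: dividing by it and comparing coefficients of `Xⁿ` gives the
recurrence. -/
theorem formalLHS_eq_zero_iff {R : Type*} [CommRing R] (z : R) (H : R⟦X⟧) :
    formalLHS z H = 0 ↔ IsRec z (fun n => PowerSeries.coeff n H) := by
  have h1 : formalLHS z H = 0 ↔
      PowerSeries.X * d⁄dX R (d⁄dX R H) + 2 * d⁄dX R H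
        = 2 * (PowerSeries.C z * (H * invSq R)) := by
    have hV := @invSq_mul R _
    unfold formalLHS
    constructor
    · intro h
      linear_combination invSq R * h - (PowerSeries.X * d⁄dX R (d⁄dX R H) + 2 * d⁄dX R H) * hV
    · intro h
      linear_combination (1 - PowerSeries.X) ^ 2 * h + 2 * PowerSeries.C z * H * hV
  rw [h1, PowerSeries.ext_iff]
  refine forall_congr' fun n => ?_
  have h2 (P : R⟦X⟧) : PowerSeries.coeff n (2 * P) = 2 * PowerSeries.coeff n P := by
    rw [two_mul, map_add, two_mul]
  have h3 : PowerSeries.coeff n (PowerSeries.X * d⁄dX R (d⁄dX R H)) =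
      n * (n + 1) * PowerSeries.coeff (n + 1) H := by
    cases n with
    | zero => simp
    | succ n =>
      rw [PowerSeries.coeff_succ_X_mul, PowerSeries.coeff_derivative, PowerSeries.coeff_derivative]
      push_cast
      ring
  have h4 : PowerSeries.coeff n (H * invSq R) =
      ∑ j ∈ Finset.range (n + 1), ((n - j : ℕ) + 1 : R) * PowerSeries.coeff j H := by
    rw [PowerSeries.coeff_mul, Finset.Nat.sum_antidiagonal_eq_sum_range_succ_mk]
    exact Finset.sum_congr rfl fun j _ => by simp [invSq, mul_comm]
  rw [map_add, h2, h2, h3, PowerSeries.coeff_C_mul, h4, PowerSeries.coeff_derivative, mul_assoc 2 z]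
  constructor <;> intro h <;> linear_combination h

theorem IsRec.unique {R : Type*} [CommRing R] [IsDomain R] [CharZero R] {z : R} {a b : ℕ → R}
    (ha : IsRec z a) (hb : IsRec z b) (h0 : a 0 = b 0) : a = b := by
  funext n
  induction n using Nat.strong_induction_on with
  | _ n ih =>
    cases n with
    | zero => exact h0
    | succ n =>
      have h := ha n
      rw [Finset.sum_congr rfl fun j hj => by rw [ih j (by simpa using hj)], ← hb n] at h
      refine mul_left_cancel₀ (mul_ne_zero ?_ ?_) h
      · exact_mod_cast Nat.succ_ne_zero n
      · exact_mod_cast Nat.succ_ne_zero (n + 1)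

/-- The initial condition on the derivative is implied by the recurrence at `n = 0`, which reads
`2 a₁ = 2 z a₀`. -/
theorem isFormalSolution_iff {H : ℂ⟦X⟧⟦X⟧} : IsFormalSolution H ↔
    IsRec (PowerSeries.X : ℂ⟦X⟧) (fun n => PowerSeries.coeff n H) ∧
      PowerSeries.coeff 0 H = 1 := by
  have h : IsFormalSolution H ↔ formalLHS (PowerSeries.X : ℂ⟦X⟧) H = 0 ∧
    PowerSeries.constantCoeff H = 1 ∧
    PowerSeries.constantCoeff (d⁄dX ℂ⟦X⟧ H) = (PowerSeries.X : ℂ⟦X⟧) := Iff.rfl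
  rw [h, formalLHS_eq_zero_iff, ← PowerSeries.coeff_zero_eq_constantCoeff_apply,
    ← PowerSeries.coeff_zero_eq_constantCoeff_apply, PowerSeries.coeff_derivative]
  refine and_congr_right fun hr => ⟨fun h => h.1, fun h => ⟨h, ?_⟩⟩
  have h1 := hr 0
  simp only [h, Nat.cast_zero, zero_add, one_mul, Finset.range_one, Finset.sum_singleton, mul_one,
    Nat.sub_zero] at h1
  have : CharZero ℂ⟦X⟧ := algebraRat.charZero _
  simpa using mul_left_cancel₀ two_ne_zero h1

/-! ### Power series representing functions on a disc -/

/-- The power series `P` converges to `f` on the open disc of radius `r` around `0`. -/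
def Represents (r : ℝ) (f : ℂ → ℂ) (P : ℂ⟦X⟧) : Prop :=
  ∀ u : ℂ, ‖u‖ < r → HasSum (fun n => PowerSeries.coeff n P * u ^ n) (f u)

namespace Represents

variable {r : ℝ} {f g : ℂ → ℂ} {P Q : ℂ⟦X⟧}

theorem congr (h : Represents r f P) (hfg : ∀ u, ‖u‖ < r → f u = g u) : Represents r g P :=
  fun u hu => hfg u hu ▸ h u hu

theorem mono (h : Represents r f P) {r' : ℝ} (hr : r' ≤ r) : Represents r' f P :=
  fun u hu => h u (hu.trans_le hr)

theorem add (hf : Represents r f P) (hg : Represents r g Q) :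
    Represents r (fun u => f u + g u) (P + Q) := fun u hu => by
  simpa [add_mul] using (hf u hu).add (hg u hu)

theorem sub (hf : Represents r f P) (hg : Represents r g Q) :
    Represents r (fun u => f u - g u) (P - Q) := fun u hu => by
  simpa [sub_mul] using (hf u hu).sub (hg u hu)

theorem mul (hf : Represents r f P) (hg : Represents r g Q) :
    Represents r (fun u => f u * g u) (P * Q) := fun u hu => by
  have h1 := hf u hu
  have h2 := hg u hu
  have h3 := summable_norm_sum_mul_antidiagonal_of_summable_norm h1.summable.norm h2.summable.norm
  have h4 := tsum_mul_tsum_eq_tsum_sum_antidiagonal_of_summable_norm h1.summable.norm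
    h2.summable.norm
  rw [h1.tsum_eq, h2.tsum_eq] at h4
  change HasSum _ (f u * g u)
  rw [h4]
  refine h3.of_norm.hasSum.congr_fun fun n => ?_
  rw [PowerSeries.coeff_mul, Finset.sum_mul]
  refine Finset.sum_congr rfl fun p hp => ?_
  rw [← Finset.HasAntidiagonal.mem_antidiagonal.1 hp, pow_add]
  ring

theorem const (c : ℂ) : Represents r (fun _ => c) (PowerSeries.C c) := fun u _ => by
  convert hasSum_single (f := fun n => PowerSeries.coeff n (PowerSeries.C c) * u ^ n) 0 ?_ using 1
  · simp
  · intro n hn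
    simp [PowerSeries.coeff_C, hn]

theorem id : Represents r (fun u => u) PowerSeries.X := fun u _ => by
  convert hasSum_single (f := fun n => PowerSeries.coeff n (PowerSeries.X : ℂ⟦X⟧) * u ^ n) 1 ?_
    using 1
  · simp
  · intro n hn
    simp [PowerSeries.coeff_X, hn]

theorem hasFPowerSeriesOnBall (hr : 0 < r) (h : Represents r f P) :
    HasFPowerSeriesOnBall f (FormalMultilinearSeries.ofScalars ℂ fun n => PowerSeries.coeff n P)
      0 (ENNReal.ofReal r) where
  r_le := by
    refine ENNReal.le_of_forall_nnreal_lt fun s hs => ?_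
    refine FormalMultilinearSeries.le_radius_of_summable _ ?_
    have hs' : (s : ℝ) < r := by
      have := (ENNReal.lt_ofReal_iff_toReal_lt (by simp)).1 hs
      simpa using this
    have := (h (s : ℝ) (by simpa using hs')).summable.norm
    refine this.congr fun n => ?_
    rw [FormalMultilinearSeries.ofScalars_norm]
    simp
  r_pos := by simpa using hr
  hasSum := by
    intro y hy
    have hy' : ‖y‖ < r := by
      rw [Metric.eball_ofReal] at hy
      simpa using hy
    rw [zero_add]
    refine (h y hy').congr_fun fun n => ?_
    simp [mul_comm]

theorem differentiableOn (hr : 0 < r) (h : Represents r f P) :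
    DifferentiableOn ℂ f (Metric.ball 0 r) := by
  have := (h.hasFPowerSeriesOnBall hr).differentiableOn
  rwa [Metric.eball_ofReal] at this

theorem unique (hr : 0 < r) (hP : Represents r f P) (hQ : Represents r f Q) : P = Q := by
  have h := (hP.hasFPowerSeriesOnBall hr).hasFPowerSeriesAt.eq_formalMultilinearSeries
    (hQ.hasFPowerSeriesOnBall hr).hasFPowerSeriesAt
  ext n
  have := congrArg (fun p => p.coeff n) h
  simpa using this

/-- The Taylor series of a holomorphic function. -/
noncomputable def taylor (f : ℂ → ℂ) : ℂ⟦X⟧ :=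
  PowerSeries.mk fun n => (n.factorial : ℂ)⁻¹ * iteratedDeriv n f 0

theorem of_differentiableOn (hf : DifferentiableOn ℂ f (Metric.ball 0 r)) :
    Represents r f (taylor f) := fun u hu => by
  have := Complex.hasSum_taylorSeries_on_ball hf (z := u) (by simpa using hu)
  refine this.congr_fun fun n => ?_
  simp [taylor]
  ring

theorem deriv_taylor (f : ℂ → ℂ) : taylor (deriv f) = d⁄dX ℂ (taylor f) := by
  ext n
  rw [PowerSeries.coeff_derivative]
  simp only [taylor, PowerSeries.coeff_mk, Nat.factorial_succ, iteratedDeriv_succ']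
  push_cast
  have : (n : ℂ) + 1 ≠ 0 := by exact_mod_cast Nat.succ_ne_zero n
  have : (n.factorial : ℂ) ≠ 0 := by exact_mod_cast Nat.factorial_ne_zero n
  field_simp

theorem deriv (hr : 0 < r) (h : Represents r f P) : Represents r (deriv f) (d⁄dX ℂ P) := by
  have hd := h.differentiableOn hr
  rw [h.unique hr (of_differentiableOn hd), ← deriv_taylor]
  exact of_differentiableOn (hd.deriv Metric.isOpen_ball)

theorem coeff_zero (hr : 0 < r) (h : Represents r f P) : PowerSeries.coeff 0 P = f 0 := by
  rw [h.unique hr (of_differentiableOn (h.differentiableOn hr))]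
  simp [taylor]

theorem eqOn (hf : Represents r f P) (hg : Represents r g P) :
    Set.EqOn f g (Metric.ball 0 r) := fun u hu =>
  (hf u (by simpa using hu)).unique (hg u (by simpa using hu))

theorem eq_zero_iff (hr : 0 < r) (h : Represents r f P) :
    P = 0 ↔ ∀ u, ‖u‖ < r → f u = 0 := by
  have h0 : Represents r (fun _ => 0) 0 := by simpa using const (r := r) 0
  constructor
  · rintro rfl u hu
    exact eqOn h h0 (by simpa using hu)
  · intro hf
    exact (h.congr hf).unique hr h0

end Represents

/-- The left-hand side of the differential equation for functions, denominators cleared. -/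
noncomputable def odeLHS (z : ℂ) (f : ℂ → ℂ) (u : ℂ) : ℂ :=
  u * (1 - u) ^ 2 * deriv (deriv f) u + 2 * (1 - u) ^ 2 * deriv f u - 2 * z * f u

theorem represents_odeLHS {r : ℝ} (hr : 0 < r) {f : ℂ → ℂ} {P : ℂ⟦X⟧} (z : ℂ)
    (h : Represents r f P) : Represents r (odeLHS z f) (formalLHS z P) := by
  have h1 : Represents r (fun u => 1 - u) (1 - PowerSeries.X) :=
    (by simpa using Represents.const (r := r) 1 : Represents r (fun _ => 1) 1).sub .id
  have h2 : Represents r (fun _ => 2) 2 := by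
    have := Represents.const (r := r) 2
    rwa [map_ofNat] at this
  have hs := h1.mul h1
  refine Represents.congr (r := r) (P := formalLHS z P)
    (f := fun u => u * ((1 - u) * (1 - u)) * deriv (deriv f) u
      + 2 * ((1 - u) * (1 - u)) * deriv f u - 2 * z * f u) ?_ fun u _ => by
      unfold odeLHS; ring
  have := (((Represents.id.mul hs).mul ((h.deriv hr).deriv hr)).add
    ((h2.mul hs).mul (h.deriv hr))).sub ((h2.mul (.const z)).mul h)
  convert this using 1
  unfold formalLHS
  ring

/-- A function represented by a power series solves the differential equation if and only if the
coefficients satisfy the recurrence. -/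
theorem isRec_iff_odeLHS {r : ℝ} (hr : 0 < r) {f : ℂ → ℂ} {P : ℂ⟦X⟧} (z : ℂ)
    (h : Represents r f P) :
    IsRec z (fun n => PowerSeries.coeff n P) ↔ ∀ u, ‖u‖ < r → odeLHS z f u = 0 := by
  rw [← formalLHS_eq_zero_iff, (represents_odeLHS hr z h).eq_zero_iff hr]

theorem odeLHS_eq {z u : ℂ} (f : ℂ → ℂ) (h0 : u ≠ 0) (h1 : u ≠ 1) :
    odeLHS z f u = u * (1 - u) ^ 2 * (deriv (deriv f) u + 2 / u * deriv f u +
      -(2 * z / (u * (u - 1) ^ 2)) * f u) := by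
  have : u - 1 ≠ 0 := sub_ne_zero.2 h1
  unfold odeLHS
  field_simp
  ring

theorem ode_iff_odeLHS {z u : ℂ} (f : ℂ → ℂ) (h0 : u ≠ 0) (h1 : u ≠ 1) :
    deriv (deriv f) u + 2 / u * deriv f u + -(2 * z / (u * (u - 1) ^ 2)) * f u = 0 ↔
      odeLHS z f u = 0 := by
  have : 1 - u ≠ 0 := sub_ne_zero.2 h1.symm
  rw [odeLHS_eq f h0 h1]
  simp [h0, this]

theorem IsSolution.isRec {r : ℝ} (hr : 0 < r) (hr1 : r ≤ 1) {f : ℂ → ℂ} {z : ℂ}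
    (h : IsSolution z (Metric.ball 0 r) f) :
    IsRec z (fun n => PowerSeries.coeff n (Represents.taylor f)) := by
  obtain ⟨hd, he, h0, h1⟩ := h
  rw [isRec_iff_odeLHS hr z (Represents.of_differentiableOn hd)]
  intro u hu
  rcases eq_or_ne u 0 with rfl | hu0
  -- at the singular point the cleared equation is the relation `2 f'(0) = 2 z f(0)`
  · simp [odeLHS, h0, h1]
  · have hu1 : u ≠ 1 := by
      rintro rfl
      rw [norm_one] at hu
      linarith
    exact (ode_iff_odeLHS f hu0 hu1).1 (he u (by simpa using hu) hu0 hu1)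

/-! ### The closed form solves the differential equation -/

theorem alpha_mul_alpha_add_one (z : ℂ) : alpha z * (alpha z + 1) = 2 * z := by
  have h : Complex.sqrt (8 * z + 1) ^ 2 = 8 * z + 1 := by
    simp [Complex.sqrt]
  unfold alpha
  linear_combination h / 4

/-- The power series of `₂F₁(a, b; 2; u)`. -/
noncomputable def hypergeometricPowerSeries (a b : ℂ) : ℂ⟦X⟧ :=
  PowerSeries.mk (ordinaryHypergeometricCoefficient a b 2)

theorem one_le_radius_hypergeometric (a b : ℂ) :
    1 ≤ (ordinaryHypergeometricSeries ℂ a b 2).radius := by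
  by_cases ha : ∃ k : ℕ, (k : ℂ) = -a
  · obtain ⟨k, hk⟩ := ha
    rw [← neg_neg a, ← hk, ordinaryHypergeometric_radius_top_of_neg_nat₁]
    exact le_top
  by_cases hb : ∃ k : ℕ, (k : ℂ) = -b
  · obtain ⟨k, hk⟩ := hb
    rw [← neg_neg b, ← hk, ordinaryHypergeometric_radius_top_of_neg_nat₂]
    exact le_top
  rw [ordinaryHypergeometricSeries_radius_eq_one]
  refine fun k => ⟨fun h => ha ⟨k, h⟩, fun h => hb ⟨k, h⟩, fun h => ?_⟩
  have : ((k + 2 : ℕ) : ℂ) = 0 := by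
    push_cast
    linear_combination h
  exact absurd (Nat.cast_eq_zero.1 this) (by omega)

theorem represents_hypergeometric (a b : ℂ) :
    Represents 1 (ordinaryHypergeometric a b (2 : ℂ)) (hypergeometricPowerSeries a b) := by
  intro u hu
  have h := (ordinaryHypergeometricSeries ℂ a b 2).hasSum (x := u) (by
    refine Metric.eball_subset_eball (one_le_radius_hypergeometric a b) ?_
    rw [← ENNReal.ofReal_one, Metric.eball_ofReal]
    simpa using hu)
  refine h.congr_fun fun n => ?_
  rw [ordinaryHypergeometricSeries_apply_eq]
  simp [hypergeometricPowerSeries]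

theorem coeff_hypergeometricPowerSeries_succ (a b : ℂ) (n : ℕ) :
    ((n : ℂ) + 1) * (n + 2) * PowerSeries.coeff (n + 1) (hypergeometricPowerSeries a b) =
      (n + a) * (n + b) * PowerSeries.coeff n (hypergeometricPowerSeries a b) := by
  have h2 (n : ℕ) : (ascPochhammer ℂ n).eval 2 ≠ 0 := by
    rw [Ne, ascPochhammer_eval_eq_zero_iff]
    rintro ⟨k, -, hk⟩
    have : ((k + 2 : ℕ) : ℂ) = 0 := by
      push_cast
      linear_combination hk
    exact absurd (Nat.cast_eq_zero.1 this) (by omega)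
  have h2n : (2 : ℂ) + n ≠ 0 := by
    have := h2 (n + 1)
    rw [ascPochhammer_succ_eval] at this
    exact right_ne_zero_of_mul this
  have h1n : (n : ℂ) + 1 ≠ 0 := by exact_mod_cast Nat.succ_ne_zero n
  have hf : (n.factorial : ℂ) ≠ 0 := by exact_mod_cast Nat.factorial_ne_zero n
  have := h2 n
  simp only [hypergeometricPowerSeries, PowerSeries.coeff_mk, ordinaryHypergeometricCoefficient,
    ascPochhammer_succ_eval, Nat.factorial_succ]
  push_cast
  field_simp
  ring

/-- Gauss's hypergeometric equation with third parameter `2`. -/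
theorem hypergeometricPowerSeries_ode (a b : ℂ) :
    PowerSeries.X * (1 - PowerSeries.X) * d⁄dX ℂ (d⁄dX ℂ (hypergeometricPowerSeries a b)) +
      (2 - PowerSeries.C (a + b + 1) * PowerSeries.X) * d⁄dX ℂ (hypergeometricPowerSeries a b) -
      PowerSeries.C (a * b) * hypergeometricPowerSeries a b = 0 := by
  set W := hypergeometricPowerSeries a b with hW
  have e : PowerSeries.X * (1 - PowerSeries.X) * d⁄dX ℂ (d⁄dX ℂ W) +
      (2 - PowerSeries.C (a + b + 1) * PowerSeries.X) * d⁄dX ℂ W - PowerSeries.C (a * b) * W =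
      PowerSeries.X * d⁄dX ℂ (d⁄dX ℂ W) - PowerSeries.X * (PowerSeries.X * d⁄dX ℂ (d⁄dX ℂ W))
      + (d⁄dX ℂ W + d⁄dX ℂ W) - PowerSeries.C (a + b + 1) * (PowerSeries.X * d⁄dX ℂ W)
      - PowerSeries.C (a * b) * W := by ring
  rw [e]
  ext n
  have h1 (n : ℕ) (P : ℂ⟦X⟧) : PowerSeries.coeff n (PowerSeries.X * d⁄dX ℂ P) =
      n * PowerSeries.coeff n P := by
    cases n with
    | zero => simp
    | succ n =>
      rw [PowerSeries.coeff_succ_X_mul, PowerSeries.coeff_derivative]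
      push_cast
      ring
  have h2 : PowerSeries.coeff n (PowerSeries.X * (PowerSeries.X * d⁄dX ℂ (d⁄dX ℂ W))) =
      n * (n - 1) * PowerSeries.coeff n W := by
    cases n with
    | zero => simp
    | succ n =>
      rw [PowerSeries.coeff_succ_X_mul, h1, PowerSeries.coeff_derivative]
      push_cast
      ring
  obtain ⟨s, hs⟩ : ∃ s, s = a + b + 1 := ⟨_, rfl⟩
  rw [← hs]
  simp only [map_sub, map_add, h1, h2, PowerSeries.coeff_C_mul, PowerSeries.coeff_derivative,
    map_zero]
  have := coeff_hypergeometricPowerSeries_succ a b n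
  rw [← hW] at this
  rw [hs]
  linear_combination this

theorem one_sub_mem_slitPlane {u : ℂ} (hu : ‖u‖ < 1) : 1 - u ∈ Complex.slitPlane := by
  left
  have := (Complex.re_le_norm u).trans_lt hu
  simpa using this

/-- The Taylor series `P` of the principal branch of `(1 - u)^(-α)` satisfies `(1 - X) P' = α P`
formally. -/
theorem exists_represents_cpow (α : ℂ) : ∃ P : ℂ⟦X⟧,
    Represents 1 (fun u => (1 - u) ^ (-α)) P ∧
      (1 - PowerSeries.X) * d⁄dX ℂ P = PowerSeries.C α * P := by
  have hder (u : ℂ) (hu : ‖u‖ < 1) : HasDerivAt (fun u : ℂ => (1 - u) ^ (-α))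
      (-α * (1 - u) ^ (-α - 1) * (-1)) u :=
    ((hasDerivAt_id u).const_sub 1).cpow_const (one_sub_mem_slitPlane hu)
  have hd : DifferentiableOn ℂ (fun u : ℂ => (1 - u) ^ (-α)) (Metric.ball 0 1) := fun u hu =>
    (hder u (by simpa using hu)).differentiableAt.differentiableWithinAt
  have hP := Represents.of_differentiableOn hd
  refine ⟨_, hP, ?_⟩
  have h1 : Represents 1 (fun u => 1 - u) (1 - PowerSeries.X) :=
    (by simpa using Represents.const (r := 1) 1 : Represents 1 (fun _ => 1) 1).sub .id
  refine ((h1.mul (hP.deriv one_pos)).congr fun u hu => ?_).unique one_pos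
    ((Represents.const α).mul hP)
  have hne : 1 - u ≠ 0 := Complex.slitPlane_ne_zero (one_sub_mem_slitPlane hu)
  rw [(hder u hu).deriv, Complex.cpow_sub _ _ hne, Complex.cpow_one]
  field_simp

/-- The product of the hypergeometric series `W` and the series `P` of `(1 - u)^(-α)` solves the
differential equation formally, by Gauss's equation for `W`, the identity `(1 - X) P' = α P` with
its derivative, and `α (α + 1) = 2 z`. -/
theorem closedForm_represents (z : ℂ) : ∃ P : ℂ⟦X⟧, Represents 1 (fun u => closedForm u z) P ∧
    IsRec z (fun n => PowerSeries.coeff n P) := by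
  obtain ⟨P, hP, hP'⟩ := exists_represents_cpow (alpha z)
  set W := hypergeometricPowerSeries (1 - alpha z) (-alpha z) with hW
  have hWP := (represents_hypergeometric (1 - alpha z) (-alpha z)).mul hP
  refine ⟨W * P, hWP.congr fun u _ => ?_, ?_⟩
  · rw [closedForm, Complex.cpow_neg, div_eq_mul_inv]
  · rw [← formalLHS_eq_zero_iff]
    have hW' := hypergeometricPowerSeries_ode (1 - alpha z) (-alpha z)
    rw [← hW] at hW'
    have hP'' := congrArg (d⁄dX ℂ) hP'
    have hα : (PowerSeries.C (alpha z) * (PowerSeries.C (alpha z) + 1) : ℂ⟦X⟧)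
        = 2 * PowerSeries.C z := by
      rw [← map_one (PowerSeries.C (R := ℂ)), ← map_add, ← map_mul, alpha_mul_alpha_add_one,
        map_mul, map_ofNat]
    simp only [Derivation.leibniz, map_sub, smul_eq_mul, PowerSeries.derivative_X,
      PowerSeries.derivative_C, Derivation.map_one_eq_zero] at hP''
    simp only [map_add, map_sub, map_mul, map_neg, map_one] at hW'
    unfold formalLHS
    simp only [Derivation.leibniz, smul_eq_mul, map_add]
    set X : ℂ⟦X⟧ := PowerSeries.X
    set A : ℂ⟦X⟧ := PowerSeries.C (alpha z)
    linear_combination (1 - X) * P * hW' + W * X * (1 - X) * hP''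
      + (2 * (1 - X) * W + W * X * (A + 1) + 2 * X * (1 - X) * d⁄dX ℂ W) * hP' + W * P * hα

theorem closedForm_zero (z : ℂ) : closedForm 0 z = 1 := by
  simp [closedForm]

theorem isSolution_of_isRec {r : ℝ} (hr : 0 < r) {f : ℂ → ℂ} {P : ℂ⟦X⟧} {z : ℂ}
    (h : Represents r f P) (hP : IsRec z (fun n => PowerSeries.coeff n P)) (h0 : f 0 = 1) :
    IsSolution z (Metric.ball 0 r) f := by
  have hode := (isRec_iff_odeLHS hr z h).1 hP
  refine ⟨h.differentiableOn hr, fun u hu hu0 hu1 => ?_, h0, ?_⟩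
  · exact (ode_iff_odeLHS f hu0 hu1).2 (hode u (by simpa using hu))
  · have := hode 0 (by simpa using hr)
    simp only [odeLHS, h0] at this
    linear_combination this / 2

theorem closedForm_isSolution (z : ℂ) :
    IsSolution z (Metric.ball 0 1) (fun u => closedForm u z) := by
  obtain ⟨P, hP, hrec⟩ := closedForm_represents z
  exact isSolution_of_isRec one_pos hP hrec (closedForm_zero z)

theorem IsSolution.eqOn_closedForm {r : ℝ} (hr : 0 < r) (hr1 : r ≤ 1) {f : ℂ → ℂ} {z : ℂ}
    (h : IsSolution z (Metric.ball 0 r) f) :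
    Set.EqOn f (fun u => closedForm u z) (Metric.ball 0 r) := by
  obtain ⟨P, hP, hrec⟩ := closedForm_represents z
  have hf := Represents.of_differentiableOn h.1
  have : Represents.taylor f = P := by
    ext n
    refine congrFun ((h.isRec hr hr1).unique hrec ?_) n
    rw [hf.coeff_zero hr, hP.coeff_zero one_pos, closedForm_zero, h.2.2.1]
  rw [this] at hf
  exact hf.eqOn (hP.mono hr1)

theorem hasSum_closedForm {z : ℂ} {a : ℕ → ℂ} (ha : IsRec z a) (h0 : a 0 = 1) {u : ℂ}
    (hu : ‖u‖ < 1) : HasSum (fun n => a n * u ^ n) (closedForm u z) := by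
  obtain ⟨P, hP, hrec⟩ := closedForm_represents z
  have : a = fun n => PowerSeries.coeff n P := by
    refine ha.unique hrec ?_
    rw [hP.coeff_zero one_pos, closedForm_zero, h0]
  rw [this]
  exact hP u hu

/-! ### The two slit planes -/

theorem isOpen_slitU : IsOpen slitU := by
  have : slitU = (((↑) : ℝ → ℂ) '' Set.Ici 1)ᶜ := by
    ext u
    simp [slitU, eq_comm]
  rw [this]
  exact (Complex.isometry_ofReal.isClosedEmbedding.isClosedMap _ isClosed_Ici).isOpen_compl

theorem isOpen_slitZ : IsOpen slitZ := by
  have : slitZ = (((↑) : ℝ → ℂ) '' Set.Iic (-1 / 8))ᶜ := by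
    ext u
    simp [slitZ, eq_comm]
  rw [this]
  exact (Complex.isometry_ofReal.isClosedEmbedding.isClosedMap _ isClosed_Iic).isOpen_compl

theorem mul_mem_slitU {u : ℂ} (hu : u ∈ slitU) {s : ℝ} (h0 : 0 ≤ s) (h1 : s ≤ 1) :
    (s : ℂ) * u ∈ slitU := by
  rintro ⟨x, hx, h⟩
  have hs : s ≠ 0 := by
    rintro rfl
    rw [Complex.ofReal_zero, zero_mul] at h
    have : x = 0 := by exact_mod_cast h.symm
    linarith
  have hs' : 0 < s := lt_of_le_of_ne h0 hs.symm
  refine hu ⟨x / s, ?_, ?_⟩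
  · rw [le_div_iff₀ hs']
    linarith
  · have : (s : ℂ) ≠ 0 := by exact_mod_cast hs
    rw [Complex.ofReal_div, ← h]
    field_simp

theorem mul_mem_slitZ {z : ℂ} (hz : z ∈ slitZ) {s : ℝ} (h0 : 0 ≤ s) (h1 : s ≤ 1) :
    (s : ℂ) * z ∈ slitZ := by
  rintro ⟨x, hx, h⟩
  have hs : s ≠ 0 := by
    rintro rfl
    rw [Complex.ofReal_zero, zero_mul] at h
    have : x = 0 := by exact_mod_cast h.symm
    linarith
  have hs' : 0 < s := lt_of_le_of_ne h0 hs.symm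
  refine hz ⟨x / s, ?_, ?_⟩
  · rw [div_le_iff₀ hs']
    linarith
  · have : (s : ℂ) ≠ 0 := by exact_mod_cast hs
    rw [Complex.ofReal_div, ← h]
    field_simp

theorem ball_subset_slitU : Metric.ball 0 1 ⊆ slitU := by
  rintro u hu ⟨x, hx, rfl⟩
  rw [mem_ball_zero_iff, Complex.norm_real, Real.norm_eq_abs] at hu
  exact absurd (hx.trans (le_abs_self x)) (by linarith)

theorem zero_mem_slitU : (0 : ℂ) ∈ slitU := ball_subset_slitU (by simp)

theorem zero_mem_slitZ : (0 : ℂ) ∈ slitZ := by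
  rintro ⟨x, hx, h⟩
  have : x = 0 := by exact_mod_cast h.symm
  norm_num [this] at hx

theorem isPreconnected_slitU : IsPreconnected slitU := by
  have : StarConvex ℝ 0 slitU := starConvex_zero_iff.2 fun u hu s h0 h1 => by
    simpa using mul_mem_slitU hu h0 h1
  exact (this.isPathConnected zero_mem_slitU).isConnected.isPreconnected

theorem isPreconnected_slitZ : IsPreconnected slitZ := by
  have : StarConvex ℝ 0 slitZ := starConvex_zero_iff.2 fun u hu s h0 h1 => by
    simpa using mul_mem_slitZ hu h0 h1
  exact (this.isPathConnected zero_mem_slitZ).isConnected.isPreconnected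

theorem one_sub_ne_zero_of_mem_slitU {u : ℂ} (hu : u ∈ slitU) : 1 - u ≠ 0 := by
  intro h
  exact hu ⟨1, le_rfl, by rw [Complex.ofReal_one]; linear_combination -h⟩

/-! ### Picard iteration -/

/-- The averaging operator `g ↦ ∫₀¹ (1 - s) g(su) ds`, through which the differential equation
becomes the integral equation `f(u) = 1 + 2zu ∫₀¹ (1 - s) f(su) / (1 - su)² ds`. -/
noncomputable def average (g : ℂ → ℂ) (u : ℂ) : ℂ :=
  ∫ s : ℝ in (0 : ℝ)..1, ((1 - s : ℝ) : ℂ) * g (s * u)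

theorem differentiableOn_average {U : Set ℂ} (hU : IsOpen U)
    (hs : ∀ u ∈ U, ∀ s : ℝ, 0 ≤ s → s ≤ 1 → (s : ℂ) * u ∈ U) {g : ℂ → ℂ}
    (hg : DifferentiableOn ℂ g U) : DifferentiableOn ℂ (average g) U := by
  intro u₀ hu₀
  obtain ⟨ε, hε, hεU⟩ := Metric.nhds_basis_closedBall.mem_iff.1 (hU.mem_nhds hu₀)
  have hcomp : IsCompact (Set.Icc (0 : ℝ) 1 ×ˢ Metric.closedBall u₀ ε) :=
    isCompact_Icc.prod (isCompact_closedBall _ _)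
  have hmaps : Set.MapsTo (fun p : ℝ × ℂ => (p.1 : ℂ) * p.2)
      (Set.Icc (0 : ℝ) 1 ×ˢ Metric.closedBall u₀ ε) U := fun p hp =>
    hs _ (hεU hp.2) _ hp.1.1 hp.1.2
  have hg' : ContinuousOn (deriv g) U := (hg.deriv hU).continuousOn
  obtain ⟨C, hC⟩ := hcomp.exists_bound_of_continuousOn
    (hg'.comp (f := fun p : ℝ × ℂ => (p.1 : ℂ) * p.2) (by fun_prop) hmaps)
  have hcont (φ : ℂ → ℂ) (hφ : ContinuousOn φ U) {u : ℂ} (hu : u ∈ U) :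
      ContinuousOn (fun s : ℝ => φ (s * u)) (Set.Icc 0 1) :=
    hφ.comp (by fun_prop) fun s hs' => hs u hu s hs'.1 hs'.2
  have hI : Set.uIoc (0 : ℝ) 1 ⊆ Set.Icc 0 1 := by
    rw [Set.uIoc_of_le zero_le_one]
    exact Set.Ioc_subset_Icc_self
  have key := intervalIntegral.hasDerivAt_integral_of_dominated_loc_of_deriv_le (𝕜 := ℂ)
    (μ := volume) (a := 0) (b := 1) (x₀ := u₀) (bound := fun _ => C)
    (F := fun u s => ((1 - s : ℝ) : ℂ) * g (s * u))
    (F' := fun u s => ((1 - s : ℝ) : ℂ) * (deriv g (s * u) * s))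
    (Metric.ball_mem_nhds u₀ hε) ?_ ?_ ?_ ?_ ?_ ?_
  · exact key.2.differentiableAt.differentiableWithinAt
  · filter_upwards [hU.mem_nhds hu₀] with u hu
    refine ContinuousOn.aestronglyMeasurable ?_ measurableSet_uIoc
    exact (ContinuousOn.mul (by fun_prop) (hcont g hg.continuousOn hu)).mono hI
  · refine ContinuousOn.intervalIntegrable ?_
    rw [Set.uIcc_of_le zero_le_one]
    exact ContinuousOn.mul (by fun_prop) (hcont g hg.continuousOn hu₀)
  · refine ContinuousOn.aestronglyMeasurable ?_ measurableSet_uIoc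
    exact (ContinuousOn.mul (by fun_prop) ((hcont _ hg' hu₀).mul (by fun_prop))).mono hI
  · refine Filter.Eventually.of_forall fun s hs' u hu => ?_
    have hs1 := hI hs'
    have h1 := hC (s, u) ⟨hs1, Metric.ball_subset_closedBall hu⟩
    simp only [Function.comp] at h1
    rw [norm_mul, norm_mul, Complex.norm_real, Complex.norm_real, Real.norm_of_nonneg hs1.1,
      Real.norm_of_nonneg (by linarith [hs1.2])]
    have h0 := norm_nonneg (deriv g (s * u))
    have h2 : ‖deriv g (s * u)‖ * s ≤ C := by
      nlinarith [hs1.1, hs1.2]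
    nlinarith [hs1.1, hs1.2, mul_nonneg h0 hs1.1]
  · exact intervalIntegrable_const
  · refine Filter.Eventually.of_forall fun s hs' u hu => ?_
    have hs1 := hI hs'
    have hmem : (s : ℂ) * u ∈ U := hs u (hεU (Metric.ball_subset_closedBall hu)) s hs1.1 hs1.2
    have h1 : HasDerivAt g (deriv g (s * u)) ((s : ℂ) * u) :=
      (hg.differentiableAt (hU.mem_nhds hmem)).hasDerivAt
    have h2 : HasDerivAt (fun u : ℂ => (s : ℂ) * u) s u := by
      simpa using (hasDerivAt_id u).const_mul (s : ℂ)
    exact (h1.comp u h2).const_mul _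

/-- Termwise averaging of a series dominated by a convergent numerical series on the ray
from `0` to `u`. -/
theorem hasSum_average {u : ℂ} {F : ℕ → ℂ → ℂ} {f : ℂ → ℂ} {b : ℕ → ℝ} (hb : Summable b)
    (hF : ∀ n, ContinuousOn (fun s : ℝ => F n (s * u)) (Set.Icc 0 1))
    (hFb : ∀ n, ∀ s : ℝ, 0 ≤ s → s ≤ 1 → ‖F n (s * u)‖ ≤ b n)
    (hf : ∀ s : ℝ, 0 ≤ s → s ≤ 1 → HasSum (fun n => F n (s * u)) (f (s * u))) :
    HasSum (fun n => average (F n) u) (average f u) := by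
  have hI : Set.uIoc (0 : ℝ) 1 ⊆ Set.Icc 0 1 := by
    rw [Set.uIoc_of_le zero_le_one]
    exact Set.Ioc_subset_Icc_self
  refine intervalIntegral.hasSum_integral_of_dominated_convergence (fun n _ => b n) ?_ ?_ ?_ ?_ ?_
  · intro n
    refine ContinuousOn.aestronglyMeasurable ?_ measurableSet_uIoc
    exact (ContinuousOn.mul (by fun_prop) (hF n)).mono hI
  · refine fun n => Filter.Eventually.of_forall fun s hs => ?_
    have hs1 := hI hs
    have h1 := hFb n s hs1.1 hs1.2
    rw [norm_mul, Complex.norm_real, Real.norm_of_nonneg (by linarith [hs1.2])]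
    nlinarith [norm_nonneg (F n (s * u)), hs1.1]
  · exact Filter.Eventually.of_forall fun _ _ => hb
  · exact intervalIntegrable_const
  · exact Filter.Eventually.of_forall fun s hs =>
      (hf s (hI hs).1 (hI hs).2).mul_left _

theorem average_pow (c : ℂ) (n : ℕ) (u : ℂ) :
    average (fun v => c * v ^ n) u = c / ((n + 1) * (n + 2)) * u ^ n := by
  have h : ∫ s : ℝ in (0 : ℝ)..1, (s ^ n - s ^ (n + 1)) = 1 / ((n + 1) * (n + 2) : ℝ) := by
    rw [intervalIntegral.integral_sub (by simp) (by simp), integral_pow, integral_pow]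
    have h1 : (n : ℝ) + 1 ≠ 0 := by positivity
    have h2 : (n : ℝ) + 2 ≠ 0 := by positivity
    push_cast
    simp only [one_pow, ne_eq, Nat.add_eq_zero_iff, one_ne_zero, and_false, not_false_eq_true,
      zero_pow, sub_zero]
    rw [show (n : ℝ) + 1 + 1 = n + 2 by ring]
    field_simp
    ring
  have h' : average (fun v => c * v ^ n) u
      = ∫ s : ℝ in (0 : ℝ)..1, ((s ^ n - s ^ (n + 1) : ℝ) : ℂ) * (c * u ^ n) := by
    unfold average
    congr 1
    funext s
    push_cast
    ring
  rw [h', intervalIntegral.integral_mul_const, intervalIntegral.integral_ofReal, h]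
  push_cast
  have h1 : (n : ℂ) + 1 ≠ 0 := by exact_mod_cast Nat.succ_ne_zero n
  have h2 : (n : ℂ) + 2 ≠ 0 := by exact_mod_cast Nat.succ_ne_zero (n + 1)
  field_simp

theorem represents_average {r : ℝ} {g : ℂ → ℂ} {Q : ℂ⟦X⟧} (h : Represents r g Q) :
    Represents r (average g)
      (PowerSeries.mk fun n => PowerSeries.coeff n Q / ((n + 1) * (n + 2))) := by
  intro u hu
  have hsu {s : ℝ} (h0 : 0 ≤ s) (h1 : s ≤ 1) : ‖(s : ℂ) * u‖ ≤ ‖u‖ := by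
    rw [norm_mul, Complex.norm_real, Real.norm_of_nonneg h0]
    exact mul_le_of_le_one_left (norm_nonneg _) h1
  have := hasSum_average (u := u) (F := fun n v => PowerSeries.coeff n Q * v ^ n) (f := g)
    (h u hu).summable.norm (fun n => by fun_prop) (fun n s h0 h1 => ?_)
    (fun s h0 h1 => h _ ((hsu h0 h1).trans_lt hu))
  · simpa [average_pow] using this
  · rw [norm_mul, norm_mul, norm_pow, norm_pow]
    gcongr
    exact hsu h0 h1

/-- The Picard iterates: `picard k u` is the coefficient of `zᵏ` in the extension of
the generating function. -/
noncomputable def picard : ℕ → ℂ → ℂ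
  | 0 => fun _ => 1
  | k + 1 => fun u => 2 * u * average (fun v => picard k v / (1 - v) ^ 2) u

theorem differentiableOn_picard (k : ℕ) : DifferentiableOn ℂ (picard k) slitU := by
  induction k with
  | zero => exact differentiableOn_const _
  | succ k ih =>
    refine DifferentiableOn.mul (by fun_prop) (differentiableOn_average isOpen_slitU
      (fun u hu s h0 h1 => mul_mem_slitU hu h0 h1) (ih.div (by fun_prop) fun v hv => ?_))
    exact pow_ne_zero 2 (one_sub_ne_zero_of_mem_slitU hv)

/-- Picard iterates decay factorially along a segment from `0` that stays away from `1`. -/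
theorem norm_picard_le {u : ℂ} {δ : ℝ} (hu : u ∈ slitU) (hδ : 0 < δ)
    (h : ∀ s : ℝ, 0 ≤ s → s ≤ 1 → δ ≤ ‖1 - (s : ℂ) * u‖) (k : ℕ) :
    ‖picard k u‖ ≤ (2 / δ ^ 2 * ‖u‖) ^ k / k.factorial := by
  induction k generalizing u with
  | zero => simp [picard]
  | succ k ih =>
    set c := 2 / δ ^ 2 with hc
    have hc0 : 0 < c := by positivity
    have hbound : ‖average (fun v => picard k v / (1 - v) ^ 2) u‖ ≤
        ∫ s : ℝ in (0 : ℝ)..1, (c * ‖u‖) ^ k / k.factorial / δ ^ 2 * s ^ k := by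
      refine intervalIntegral.norm_integral_le_of_norm_le zero_le_one ?_
        (Continuous.intervalIntegrable (by fun_prop) _ _)
      refine Filter.Eventually.of_forall fun s hs => ?_
      have hs0 : 0 ≤ s := hs.1.le
      have h1 := ih (u := s * u) (mul_mem_slitU hu hs0 hs.2) fun t ht0 ht1 => by
        have := h (t * s) (mul_nonneg ht0 hs0) (mul_le_one₀ ht1 hs0 hs.2)
        rwa [Complex.ofReal_mul, mul_assoc] at this
      have h2 := h s hs0 hs.2
      rw [norm_mul, Complex.norm_real, Real.norm_of_nonneg hs0] at h1
      rw [norm_mul, norm_div, norm_pow, Complex.norm_real,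
        Real.norm_of_nonneg (by linarith [hs.2])]
      calc (1 - s) * (‖picard k (s * u)‖ / ‖1 - (s : ℂ) * u‖ ^ 2)
          ≤ 1 * ((c * (s * ‖u‖)) ^ k / k.factorial / δ ^ 2) := by
            gcongr
            linarith
        _ = _ := by
            rw [show c * (s * ‖u‖) = c * ‖u‖ * s by ring, mul_pow]
            ring
    rw [intervalIntegral.integral_const_mul, integral_pow] at hbound
    simp only [one_pow, ne_eq, Nat.add_eq_zero_iff, one_ne_zero, and_false, not_false_eq_true,
      zero_pow, sub_zero] at hbound
    calc ‖picard (k + 1) u‖ = 2 * ‖u‖ * ‖average (fun v => picard k v / (1 - v) ^ 2) u‖ := by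
          simp [picard]
      _ ≤ 2 * ‖u‖ * ((c * ‖u‖) ^ k / k.factorial / δ ^ 2 * (1 / (k + 1))) := by gcongr
      _ = (c * ‖u‖) ^ (k + 1) / (k + 1).factorial := by
          rw [Nat.factorial_succ, pow_succ (c * ‖u‖) k]
          generalize (c * ‖u‖) ^ k = x
          rw [hc]
          push_cast
          field_simp

/-- The factorial bound on the Picard iterates and on the integrands of the next ones, uniformly
on the segments from `0` to the points near `u₀`, which stay away from `1` by compactness. -/
theorem exists_picard_bound {u₀ : ℂ} (hu₀ : u₀ ∈ slitU) : ∃ V, IsOpen V ∧ u₀ ∈ V ∧ V ⊆ slitU ∧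
    ∃ C : ℝ, 0 ≤ C ∧ ∀ u ∈ V, ∀ k, ∀ s : ℝ, 0 ≤ s → s ≤ 1 →
      ‖picard k (s * u)‖ ≤ C ^ k / k.factorial ∧
      ‖picard k (s * u) / (1 - s * u) ^ 2‖ ≤ C * (C ^ k / k.factorial) := by
  obtain ⟨ε, hε, hεU⟩ := Metric.nhds_basis_closedBall.mem_iff.1 (isOpen_slitU.mem_nhds hu₀)
  have hcomp : IsCompact (Set.Icc (0 : ℝ) 1 ×ˢ Metric.closedBall u₀ ε) :=
    isCompact_Icc.prod (isCompact_closedBall _ _)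
  obtain ⟨p, hp, hmin⟩ := hcomp.exists_isMinOn
    ⟨(0, u₀), ⟨by simp, by simp [hε.le]⟩⟩
    (f := fun p : ℝ × ℂ => ‖1 - (p.1 : ℂ) * p.2‖) (by fun_prop)
  set δ := ‖1 - (p.1 : ℂ) * p.2‖ with hδ
  have hδ0 : 0 < δ := norm_pos_iff.2
    (one_sub_ne_zero_of_mem_slitU (mul_mem_slitU (hεU hp.2) hp.1.1 hp.1.2))
  refine ⟨Metric.ball u₀ ε, Metric.isOpen_ball, Metric.mem_ball_self hε,
    Metric.ball_subset_closedBall.trans hεU, 2 / δ ^ 2 * (‖u₀‖ + ε + 1), by positivity, ?_⟩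
  intro u hu k s h0 h1
  have huc := Metric.ball_subset_closedBall hu
  have hδ' : ∀ s : ℝ, 0 ≤ s → s ≤ 1 → δ ≤ ‖1 - (s : ℂ) * u‖ := fun s h0 h1 =>
    hmin (a := (s, u)) ⟨⟨h0, h1⟩, huc⟩
  have hb := norm_picard_le (u := s * u) (mul_mem_slitU (hεU huc) h0 h1) hδ0
    (fun t ht0 ht1 => by
      have := hδ' (t * s) (mul_nonneg ht0 h0) (mul_le_one₀ ht1 h0 h1)
      rwa [Complex.ofReal_mul, mul_assoc] at this) k
  have hnu : ‖(s : ℂ) * u‖ ≤ ‖u₀‖ + ε + 1 := by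
    rw [norm_mul, Complex.norm_real, Real.norm_of_nonneg h0]
    have h3 : ‖u‖ ≤ ‖u₀‖ + ε := by
      have h4 := norm_sub_norm_le u u₀
      have h5 : ‖u - u₀‖ < ε := by simpa [dist_eq_norm] using hu
      linarith
    nlinarith [norm_nonneg u]
  have hb' : ‖picard k (s * u)‖ ≤ (2 / δ ^ 2 * (‖u₀‖ + ε + 1)) ^ k / k.factorial :=
    hb.trans (by gcongr)
  refine ⟨hb', ?_⟩
  rw [norm_div, norm_pow, div_eq_inv_mul]
  have h6 : (‖1 - (s : ℂ) * u‖ ^ 2)⁻¹ ≤ 2 / δ ^ 2 * (‖u₀‖ + ε + 1) := by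
    calc (‖1 - (s : ℂ) * u‖ ^ 2)⁻¹ ≤ (δ ^ 2)⁻¹ := by
          gcongr
          exact hδ' s h0 h1
      _ ≤ (δ ^ 2)⁻¹ * (2 * (‖u₀‖ + ε + 1)) := by
          refine le_mul_of_one_le_right (by positivity) ?_
          linarith [norm_nonneg u₀]
      _ = _ := by ring
  gcongr

/-- Pairing of two sequences of holomorphic functions, a jointly analytic function of two
variables: both sequences are viewed as holomorphic maps into `ℓ²` and its dual. -/
theorem analyticOnNhd_tsum_mul {V W : Set ℂ} (hV : IsOpen V) (hW : IsOpen W) {a b : ℕ → ℂ → ℂ}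
    {α β : ℕ → ℝ} (hα : Summable α) (hβ : Summable β) (ha : ∀ k, DifferentiableOn ℂ (a k) V)
    (hb : ∀ k, DifferentiableOn ℂ (b k) W) (haα : ∀ k, ∀ u ∈ V, ‖a k u‖ ≤ α k)
    (hbβ : ∀ k, ∀ z ∈ W, ‖b k z‖ ≤ β k) :
    AnalyticOnNhd ℂ (fun p : ℂ × ℂ => ∑' k, a k p.1 * b k p.2) (V ×ˢ W) := by
  let e : ℕ → lp (fun _ : ℕ => ℂ) 2 := fun k => lp.single 2 k (1 : ℂ)
  have he (k : ℕ) : ‖e k‖ = 1 := by simp [e, lp.norm_single]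
  have hee (k j : ℕ) : inner ℂ (e k) (e j) = if k = j then 1 else 0 := by
    rw [lp.inner_single_left]
    simp [e, lp.single_apply, Pi.single_apply]
  let A : ℂ → lp (fun _ : ℕ => ℂ) 2 := fun u => ∑' k, a k u • e k
  let B : ℂ → (lp (fun _ : ℕ => ℂ) 2 →L[ℂ] ℂ) := fun z => ∑' k, b k z • innerSL ℂ (e k)
  have hAb (k : ℕ) (u : ℂ) (hu : u ∈ V) : ‖a k u • e k‖ ≤ α k := by
    rw [norm_smul, he, mul_one]
    exact haα k u hu
  have hBb (k : ℕ) (z : ℂ) (hz : z ∈ W) : ‖b k z • innerSL ℂ (e k)‖ ≤ β k := by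
    rw [norm_smul, innerSL_apply_norm, he, mul_one]
    exact hbβ k z hz
  have hA : DifferentiableOn ℂ A V := Complex.differentiableOn_tsum_of_summable_norm hα
    (fun k => (ha k).smul_const _) hV hAb
  have hB : DifferentiableOn ℂ B W := Complex.differentiableOn_tsum_of_summable_norm hβ
    (fun k => (hb k).smul_const _) hW hBb
  have hAB (u : ℂ) (hu : u ∈ V) (z : ℂ) (hz : z ∈ W) : B z (A u) = ∑' k, a k u * b k z := by
    have h1 : HasSum (fun k => a k u • e k) (A u) :=
      (Summable.of_norm_bounded hα fun k => hAb k u hu).hasSum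
    have h2 : HasSum (fun k => b k z • innerSL ℂ (e k)) (B z) :=
      (Summable.of_norm_bounded hβ fun k => hBb k z hz).hasSum
    have h3 : HasSum (fun k => (b k z • innerSL ℂ (e k)) (A u)) (B z (A u)) :=
      h2.mapL (ContinuousLinearMap.apply ℂ ℂ (A u))
    rw [← h3.tsum_eq]
    refine tsum_congr fun k => ?_
    have h4 : HasSum (fun j => innerSL ℂ (e k) (a j u • e j)) (innerSL ℂ (e k) (A u)) :=
      h1.mapL (innerSL ℂ (e k))
    have h5 : innerSL ℂ (e k) (A u) = a k u := by
      rw [← h4.tsum_eq, tsum_eq_single k]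
      · simp [he]
      · intro j hj
        simp [hee, hj.symm]
    rw [_root_.smul_apply, h5, smul_eq_mul, mul_comm]
  rintro ⟨u, z⟩ ⟨hu, hz⟩
  have h1 : AnalyticAt ℂ (fun p : ℂ × ℂ => A p.1) (u, z) :=
    (hA.analyticAt (hV.mem_nhds hu)).comp_of_eq analyticAt_fst rfl
  have h2 : AnalyticAt ℂ (fun p : ℂ × ℂ => B p.2) (u, z) :=
    (hB.analyticAt (hW.mem_nhds hz)).comp_of_eq analyticAt_snd rfl
  have h3 : AnalyticAt ℂ (fun p : ℂ × ℂ => B p.2 (A p.1)) (u, z) :=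
    ((ContinuousLinearMap.id ℂ (lp (fun _ : ℕ => ℂ) 2 →L[ℂ] ℂ)).analyticAt_bilinear
      (B z, A u)).comp_of_eq (h2.prod h1) rfl
  refine h3.congr ?_
  filter_upwards [(hV.prod hW).mem_nhds ⟨hu, hz⟩] with p hp
  exact hAB p.1 hp.1 p.2 hp.2

/-- The extension of the generating function to the slit plane, an entire function of `z`. -/
noncomputable def extension (p : ℂ × ℂ) : ℂ := ∑' k, picard k p.1 * p.2 ^ k

theorem summable_pow_mul_pow_div_factorial (C : ℝ) (z : ℂ) :
    Summable fun k : ℕ => C ^ k / k.factorial * ‖z‖ ^ k := by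
  refine (Real.summable_pow_div_factorial (C * ‖z‖)).congr fun k => ?_
  rw [mul_pow]
  ring

theorem analyticOnNhd_extension : AnalyticOnNhd ℂ extension (slitU ×ˢ Set.univ) := by
  rintro ⟨u, z⟩ ⟨hu, -⟩
  obtain ⟨V, hV, huV, hVU, C, hC, hb⟩ := exists_picard_bound hu
  -- `h_k(u) zᵏ` is split as `h_k(u) (2R)ᵏ` times `(z / 2R)ᵏ`, so that both factors are summable
  set R : ℝ := ‖z‖ + 1 with hR
  have hR0 : 0 < R := by positivity
  have hR' : ((2 * R : ℝ) : ℂ) ≠ 0 := by exact_mod_cast (by positivity : (2 * R : ℝ) ≠ 0)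
  have key := analyticOnNhd_tsum_mul hV (Metric.isOpen_ball (x := (0 : ℂ)) (ε := R))
    (a := fun k u => picard k u * ((2 * R : ℝ) : ℂ) ^ k)
    (b := fun k z => (z / ((2 * R : ℝ) : ℂ)) ^ k)
    (summable_pow_mul_pow_div_factorial C ((2 * R : ℝ) : ℂ)) summable_geometric_two
    (fun k => ((differentiableOn_picard k).mono hVU).mul_const _)
    (fun k => by fun_prop) (fun k u hu => ?_) (fun k z hz => ?_) (u, z) ⟨huV, by simp [hR]⟩
  · refine key.congr (Filter.Eventually.of_forall fun p => ?_)
    refine tsum_congr fun k => ?_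
    rw [mul_assoc, ← mul_pow, mul_div_cancel₀ _ hR']
  · rw [norm_mul, norm_pow]
    gcongr
    simpa using (hb u hu k 1 zero_le_one le_rfl).1
  · rw [norm_pow, norm_div, Complex.norm_real, Real.norm_of_nonneg (by positivity)]
    refine pow_le_pow_left₀ (by positivity) ?_ k
    rw [div_le_div_iff₀ (by positivity) two_pos]
    have : ‖z‖ < R := by simpa using hz
    linarith

/-- The integral equation equivalent to the differential equation with its initial conditions. -/
theorem extension_eq {u : ℂ} (hu : u ∈ slitU) (z : ℂ) : extension (u, z) =
    1 + 2 * z * (u * average (fun v => extension (v, z) * ((1 - v) ^ 2)⁻¹) u) := by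
  obtain ⟨V, hV, huV, hVU, C, hC, hb⟩ := exists_picard_bound hu
  have hmem (s : ℝ) (h0 : 0 ≤ s) (h1 : s ≤ 1) := mul_mem_slitU hu h0 h1
  have hS := summable_pow_mul_pow_div_factorial C z
  have hsum (s : ℝ) (h0 : 0 ≤ s) (h1 : s ≤ 1) :
      HasSum (fun k => picard k (s * u) * z ^ k) (extension (s * u, z)) := by
    refine (Summable.of_norm_bounded hS fun k => ?_).hasSum
    rw [norm_mul, norm_pow]
    gcongr
    exact (hb u huV k s h0 h1).1
  have h1 : HasSum (fun k => picard k u * z ^ k) (extension (u, z)) := by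
    simpa using hsum 1 zero_le_one le_rfl
  have h2 : HasSum (fun k => average (fun v => picard k v / (1 - v) ^ 2 * z ^ k) u)
      (average (fun v => extension (v, z) * ((1 - v) ^ 2)⁻¹) u) := by
    refine hasSum_average (hS.mul_left C) (fun k => ?_) (fun k s h0 h1 => ?_) fun s h0 h1 => ?_
    · have hc : ContinuousOn (fun v => picard k v / (1 - v) ^ 2 * z ^ k) slitU :=
        ((differentiableOn_picard k).continuousOn.div (by fun_prop) fun v hv =>
          pow_ne_zero 2 (one_sub_ne_zero_of_mem_slitU hv)).mul continuousOn_const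
      exact hc.comp (f := fun s : ℝ => (s : ℂ) * u) (by fun_prop) fun s hs => hmem s hs.1 hs.2
    · rw [norm_mul, norm_pow, ← mul_assoc]
      gcongr
      exact (hb u huV k s h0 h1).2
    · refine ((hsum s h0 h1).mul_right ((1 - s * u) ^ 2)⁻¹).congr_fun fun k => ?_
      rw [div_eq_mul_inv]
      ring
  have h3 : HasSum (fun k => picard (k + 1) u * z ^ (k + 1))
      (2 * z * (u * average (fun v => extension (v, z) * ((1 - v) ^ 2)⁻¹) u)) := by
    refine ((h2.mul_left u).mul_left (2 * z)).congr_fun fun k => ?_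
    have : average (fun v => picard k v / (1 - v) ^ 2 * z ^ k) u =
        average (fun v => picard k v / (1 - v) ^ 2) u * z ^ k := by
      unfold average
      rw [← intervalIntegral.integral_mul_const]
      simp only [mul_assoc]
    rw [this, picard]
    ring
  have h4 := h1.unique ((hasSum_nat_add_iff' 1).1 (by simpa [picard] using h3) : HasSum _
    (1 + 2 * z * (u * average (fun v => extension (v, z) * ((1 - v) ^ 2)⁻¹) u)))
  exact h4

theorem differentiableOn_extension (z : ℂ) :
    DifferentiableOn ℂ (fun u => extension (u, z)) slitU := fun u hu => by
  have h : AnalyticAt ℂ (fun u => extension (u, z)) u :=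
    (analyticOnNhd_extension (u, z) ⟨hu, trivial⟩).comp_of_eq (analyticAt_id.prod analyticAt_const)
      rfl
  exact h.differentiableAt.differentiableWithinAt

theorem extension_zero (z : ℂ) : extension (0, z) = 1 := by
  simpa using extension_eq zero_mem_slitU z

theorem represents_inv_sq : Represents 1 (fun v => ((1 - v) ^ 2)⁻¹) (invSq ℂ) := by
  have hne (v : ℂ) (hv : v ∈ Metric.ball (0 : ℂ) 1) : (1 - v) ^ 2 ≠ 0 :=
    pow_ne_zero 2 (one_sub_ne_zero_of_mem_slitU (ball_subset_slitU hv))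
  have hd : DifferentiableOn ℂ (fun v : ℂ => ((1 - v) ^ 2)⁻¹) (Metric.ball 0 1) :=
    DifferentiableOn.inv (by fun_prop) hne
  have h := Represents.of_differentiableOn hd
  have h0 : Represents 1 (fun _ => 1) 1 := by simpa using Represents.const (r := 1) 1
  have h1 : Represents 1 (fun u => 1 - u) (1 - PowerSeries.X) := h0.sub .id
  have h2 := ((h.mul (h1.mul h1)).congr (g := fun _ => 1) fun u hu => by
    have := hne u (by simpa using hu)
    rw [← pow_two, inv_mul_cancel₀ this]).unique one_pos h0
  have h3 := @invSq_mul ℂ _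
  rwa [show Represents.taylor (fun v : ℂ => ((1 - v) ^ 2)⁻¹) = invSq ℂ by
    linear_combination invSq ℂ * h2 - Represents.taylor (fun v : ℂ => ((1 - v) ^ 2)⁻¹) * h3] at h

/-- Near `0` the integral equation, read on Taylor coefficients, is the recurrence. -/
theorem isSolution_extension_ball (z : ℂ) :
    IsSolution z (Metric.ball 0 1) (fun u => extension (u, z)) := by
  have h := Represents.of_differentiableOn
    ((differentiableOn_extension z).mono ball_subset_slitU)
  set P := Represents.taylor (fun u => extension (u, z)) with hP
  refine isSolution_of_isRec one_pos h ?_ (extension_zero z)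
  have h0 : Represents 1 (fun _ => 1) 1 := by simpa using Represents.const (r := 1) 1
  have h1 := h0.add ((Represents.const (2 * z)).mul
    (Represents.id.mul (represents_average (h.mul represents_inv_sq))))
  have h2 := h.unique one_pos (h1.congr fun u hu =>
    (extension_eq (ball_subset_slitU (by simpa using hu)) z).symm)
  intro n
  have h3 := congrArg (PowerSeries.coeff (n + 1)) h2
  rw [map_add, PowerSeries.coeff_C_mul, PowerSeries.coeff_succ_X_mul, PowerSeries.coeff_mk,
    PowerSeries.coeff_one, if_neg (Nat.succ_ne_zero n), PowerSeries.coeff_mul,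
    Finset.Nat.sum_antidiagonal_eq_sum_range_succ_mk] at h3
  have h4 : (n : ℂ) + 1 ≠ 0 := by exact_mod_cast Nat.succ_ne_zero n
  have h5 : (n : ℂ) + 2 ≠ 0 := by exact_mod_cast Nat.succ_ne_zero (n + 1)
  change _ * PowerSeries.coeff (n + 1) P = _
  rw [h3]
  field_simp
  rw [mul_zero, zero_add]
  refine congrArg _ (Finset.sum_congr rfl fun j _ => ?_)
  simp [invSq, mul_comm]

theorem extension_eq_closedForm {u : ℂ} (hu : ‖u‖ < 1) (z : ℂ) :
    extension (u, z) = closedForm u z :=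
  (isSolution_extension_ball z).eqOn_closedForm one_pos le_rfl (by simpa using hu)

/-- The differential equation propagates from the unit disc to the connected slit plane by the
identity theorem. -/
theorem isSolution_extension (z : ℂ) : IsSolution z slitU (fun u => extension (u, z)) := by
  have hb := isSolution_extension_ball z
  have hd := differentiableOn_extension z
  refine ⟨hd, fun u hu hu0 hu1 => ?_, hb.2.2⟩
  rw [ode_iff_odeLHS _ hu0 hu1]
  have hd1 := hd.deriv isOpen_slitU
  have hd2 := hd1.deriv isOpen_slitU
  have hD : DifferentiableOn ℂ (odeLHS z fun u => extension (u, z)) slitU := by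
    unfold odeLHS
    exact (((DifferentiableOn.mul (by fun_prop) hd2).add
      (DifferentiableOn.mul (by fun_prop) hd1)).sub (DifferentiableOn.mul (by fun_prop) hd))
  have hE : Set.EqOn (odeLHS z fun u => extension (u, z)) (fun _ => 0) slitU := by
    refine (hD.analyticOnNhd isOpen_slitU).eqOn_of_preconnected_of_eventuallyEq
      analyticOnNhd_const isPreconnected_slitU zero_mem_slitU ?_
    filter_upwards [Metric.ball_mem_nhds (0 : ℂ) one_pos] with v hv
    have hv' : ‖v‖ < 1 := by simpa using hv
    rcases eq_or_ne v 0 with rfl | hv0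
    · simp [odeLHS, hb.2.2.1, hb.2.2.2]
    · have hv1 : v ≠ 1 := by
        rintro rfl
        simp at hv'
      exact (ode_iff_odeLHS _ hv0 hv1).1 (hb.2.1 v hv hv0 hv1)
  exact hE hu

theorem extension_unique {Ψ : ℂ × ℂ → ℂ} (hΨ : AnalyticOnNhd ℂ Ψ (slitU ×ˢ slitZ))
    (h : ∀ u z : ℂ, ‖u‖ < 1 → z ∈ slitZ → Ψ (u, z) = closedForm u z) :
    Set.EqOn Ψ extension (slitU ×ˢ slitZ) := by
  refine hΨ.eqOn_of_preconnected_of_eventuallyEq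
    (analyticOnNhd_extension.mono (Set.prod_mono le_rfl (Set.subset_univ _)))
    (isPreconnected_slitU.prod isPreconnected_slitZ) (z₀ := (0, 0))
    ⟨zero_mem_slitU, zero_mem_slitZ⟩ ?_
  filter_upwards [prod_mem_nhds (Metric.ball_mem_nhds (0 : ℂ) one_pos)
    (isOpen_slitZ.mem_nhds zero_mem_slitZ)] with p hp
  have hp1 : ‖p.1‖ < 1 := by simpa using hp.1
  rw [h p.1 p.2 hp1 hp.2, ← extension_eq_closedForm hp1]

/-! ### Extreme points of chain hulls -/

/-- The number of vertices of the convex hull of `(1,0)`, `(0,1)` and the set `S`. -/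
noncomputable def hullCount (S : Set (ℝ × ℝ)) : ℕ :=
  ((convexHull ℝ ({((1 : ℝ), (0 : ℝ)), ((0 : ℝ), (1 : ℝ))} ∪ S)).extremePoints ℝ).ncard

/-- The interior of the triangle. -/
def openTriangle : Set (ℝ × ℝ) := {p | 0 < p.1 ∧ 0 < p.2 ∧ p.1 + p.2 < 1}

theorem image_extremePoints_of_injective {E F : Type*} [AddCommGroup E] [Module ℝ E]
    [AddCommGroup F] [Module ℝ F] (f : E →ᵃ[ℝ] F) (hf : Function.Injective f) (s : Set E) :
    (f '' s).extremePoints ℝ = f '' s.extremePoints ℝ := by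
  ext b
  constructor
  · intro hb
    obtain ⟨a, ha, rfl⟩ := hb.1
    refine ⟨a, ⟨ha, fun x hx y hy hxy => ?_⟩, rfl⟩
    refine hf (hb.2 (Set.mem_image_of_mem f hx) (Set.mem_image_of_mem f hy) ?_)
    rw [← image_openSegment]
    exact Set.mem_image_of_mem f hxy
  · rintro ⟨a, ha, rfl⟩
    refine ⟨Set.mem_image_of_mem f ha.1, ?_⟩
    rintro _ ⟨x, hx, rfl⟩ _ ⟨y, hy, rfl⟩ hxy
    rw [← image_openSegment, hf.mem_set_image] at hxy
    rw [ha.2 hx hy hxy]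

section Apex

variable {Y : Set (ℝ × ℝ)} {c : ℝ}

theorem convexHull_base_subset (hY : Y ⊆ openTriangle) {w : ℝ × ℝ}
    (hw : w ∈ convexHull ℝ ({((1 : ℝ), (0 : ℝ)), ((0 : ℝ), (1 : ℝ))} ∪ Y)) :
    0 ≤ w.1 ∧ 0 ≤ w.2 ∧ w.1 + w.2 ≤ 1 := by
  have hc : Convex ℝ {w : ℝ × ℝ | 0 ≤ w.1 ∧ 0 ≤ w.2 ∧ w.1 + w.2 ≤ 1} := by
    rintro ⟨a, b⟩ ⟨h1, h2, h3⟩ ⟨a', b'⟩ ⟨h1', h2', h3'⟩ s t hs ht hst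
    simp only [Set.mem_ofPred_eq, Prod.smul_mk, Prod.mk_add_mk, smul_eq_mul] at *
    refine ⟨by positivity, by positivity, ?_⟩
    nlinarith
  refine convexHull_min ?_ hc hw
  rintro p ((rfl | rfl) | hp)
  · norm_num
  · norm_num
  · have := hY hp
    exact ⟨this.1.le, this.2.1.le, this.2.2.le⟩

/-- The point `(0,1)` is the only point of the hull on the line `x = 0`. -/
theorem eq_of_fst_eq_zero (hY : Y ⊆ openTriangle) {w : ℝ × ℝ}
    (hw : w ∈ convexHull ℝ ({((1 : ℝ), (0 : ℝ)), ((0 : ℝ), (1 : ℝ))} ∪ Y)) (h0 : w.1 = 0) :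
    w = (0, 1) := by
  have hset : ({((1 : ℝ), (0 : ℝ)), ((0 : ℝ), (1 : ℝ))} ∪ Y : Set (ℝ × ℝ)) =
      insert (0, 1) (insert (1, 0) Y) := by
    ext p
    simp only [Set.mem_union, Set.mem_insert_iff, Set.mem_singleton_iff]
    tauto
  rw [hset, convexHull_insert (Set.insert_nonempty _ _), convexJoin_singleton_left,
    Set.mem_iUnion₂] at hw
  obtain ⟨v, hv, s, t, hs, ht, hst, rfl⟩ := hw
  have hv1 : 0 < v.1 := by
    have hc : Convex ℝ {w : ℝ × ℝ | 0 < w.1} := convex_halfSpace_gt (LinearMap.fst ℝ ℝ ℝ).isLinear 0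
    refine convexHull_min ?_ hc hv
    rintro p (rfl | hp)
    · norm_num
    · exact (hY hp).1
  have ht0 : t = 0 := by
    simp only [Prod.fst_add, Prod.smul_fst, smul_eq_mul, mul_zero, zero_add] at h0
    exact (mul_eq_zero.1 h0).resolve_right hv1.ne'
  subst ht0
  rw [add_zero] at hst
  subst hst
  simp

/-- Adding an apex `(0, c)`, `c > 1`, adds exactly one extreme point. -/
theorem extremePoints_insert_apex (hY : Y ⊆ openTriangle) (hc : 1 < c) :
    (convexHull ℝ (insert (0, c) ({((1 : ℝ), (0 : ℝ)), ((0 : ℝ), (1 : ℝ))} ∪ Y))).extremePoints ℝ =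
      insert (0, c)
        ((convexHull ℝ ({((1 : ℝ), (0 : ℝ)), ((0 : ℝ), (1 : ℝ))} ∪ Y)).extremePoints ℝ) := by
  set S : Set (ℝ × ℝ) := {((1 : ℝ), (0 : ℝ)), ((0 : ℝ), (1 : ℝ))} ∪ Y with hS
  have hSne : S.Nonempty := ⟨(1, 0), by simp [hS]⟩
  have hK {w} (hw : w ∈ convexHull ℝ S) := convexHull_base_subset hY hw
  have hKM : convexHull ℝ S ⊆ convexHull ℝ (insert (0, c) S) :=
    convexHull_mono (Set.subset_insert _ _)
  have hM {m : ℝ × ℝ} (hm : m ∈ convexHull ℝ (insert (0, c) S)) :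
      ∃ w ∈ convexHull ℝ S, ∃ s t : ℝ, 0 ≤ s ∧ 0 ≤ t ∧ s + t = 1 ∧ m.1 = t * w.1 ∧
        m.2 = s * c + t * w.2 := by
    rw [convexHull_insert hSne, convexJoin_singleton_left, Set.mem_iUnion₂] at hm
    obtain ⟨w, hw, s, t, hs, ht, hst, rfl⟩ := hm
    exact ⟨w, hw, s, t, hs, ht, hst, by simp, by simp⟩
  have hMb {m : ℝ × ℝ} (hm : m ∈ convexHull ℝ (insert (0, c) S)) :
      0 ≤ m.1 ∧ 0 ≤ m.2 ∧ c * m.1 + m.2 ≤ c := by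
    obtain ⟨w, hw, s, t, hs, ht, hst, h1, h2⟩ := hM hm
    obtain ⟨hw1, hw2, hw3⟩ := hK hw
    rw [h1, h2]
    refine ⟨by positivity, by positivity, ?_⟩
    have hs' : s = 1 - t := by linarith
    subst hs'
    have : c * w.1 + w.2 ≤ c := by nlinarith
    nlinarith
  -- the part of the larger hull below the line `x + y = 1` is the smaller hull
  have hMK {m : ℝ × ℝ} (hm : m ∈ convexHull ℝ (insert (0, c) S)) (hle : m.1 + m.2 ≤ 1) :
      m ∈ convexHull ℝ S := by
    obtain ⟨w, hw, s, t, hs, ht, hst, h1, h2⟩ := hM hm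
    obtain ⟨hw1, hw2, hw3⟩ := hK hw
    have he1 : ((1 : ℝ), (0 : ℝ)) ∈ convexHull ℝ S := subset_convexHull _ _ (by simp [hS])
    have he2 : ((0 : ℝ), (1 : ℝ)) ∈ convexHull ℝ S := subset_convexHull _ _ (by simp [hS])
    -- the segment from the apex to `w` crosses the line `x + y = 1` at `d`
    set σ := w.1 + w.2 with hσ
    have hcσ : 0 < c - σ := by linarith
    set q := (1 - σ) / (c - σ) with hq
    have hq0 : 0 ≤ q := div_nonneg (by linarith) hcσ.le
    have hq1 : q < 1 := by
      rw [hq, div_lt_one hcσ]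
      linarith
    have hqc : q * (c - σ) = 1 - σ := div_mul_cancel₀ _ hcσ.ne'
    have hd : ((1 - q) * w.1, q * c + (1 - q) * w.2) ∈ convexHull ℝ S := by
      have hα : 0 ≤ (1 - q) * w.1 := mul_nonneg (by linarith) hw1
      have hβ : 0 ≤ q * c + (1 - q) * w.2 :=
        add_nonneg (mul_nonneg hq0 (by linarith)) (mul_nonneg (by linarith) hw2)
      have := (convex_convexHull ℝ S) he1 he2 hα hβ (by rw [hσ] at hqc; linarith)
      simpa using this
    -- `m` lies between `d` and `w`
    have hsq : s ≤ q := by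
      have ht' : t = 1 - s := by linarith
      subst ht'
      have : s * (c - σ) ≤ q * (c - σ) := by
        rw [hqc, hσ]
        rw [h1, h2] at hle
        linarith
      exact le_of_mul_le_mul_right this hcσ
    rcases hq0.eq_or_lt with h0 | h0
    · have hs0 : s = 0 := le_antisymm (h0 ▸ hsq) hs
      have ht1 : t = 1 := by linarith
      have : m = w := by
        ext
        · rw [h1, ht1, one_mul]
        · rw [h2, hs0, ht1]
          ring
      rwa [this]
    · have := (convex_convexHull ℝ S) hd hw (div_nonneg hs h0.le)
        (sub_nonneg.2 ((div_le_one h0).2 hsq)) (by ring)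
      convert this using 1
      have ht' : t = 1 - s := by linarith
      ext
      · rw [h1, ht']
        simp
        field_simp
        ring
      · rw [h2, ht']
        simp
        field_simp
        ring
  apply Set.Subset.antisymm
  · intro v hv
    rcases extremePoints_convexHull_subset hv with h | h
    · exact Or.inl h
    · exact Or.inr (inter_extremePoints_subset_extremePoints_of_subset hKM
        ⟨subset_convexHull _ _ h, hv⟩)
  · rintro v (rfl | hv)
    · refine ⟨subset_convexHull _ _ (Set.mem_insert _ _), ?_⟩
      rintro m hm m' hm' ⟨s, t, hs, ht, hst, h⟩
      obtain ⟨a1, a2, a3⟩ := hMb hm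
      obtain ⟨b1, b2, b3⟩ := hMb hm'
      have e1 : s * m.1 + t * m'.1 = 0 := by simpa using congrArg Prod.fst h
      have e2 : s * m.2 + t * m'.2 = c := by simpa using congrArg Prod.snd h
      have m1 : m.1 = 0 := by nlinarith [mul_nonneg ht.le b1, mul_nonneg hs.le a1]
      have m1' : m'.1 = 0 := by nlinarith [mul_nonneg ht.le b1, mul_nonneg hs.le a1]
      rw [m1] at a3
      rw [m1'] at b3
      have ht' : t = 1 - s := by linarith
      ext
      · exact m1
      · refine le_antisymm (by simpa using a3) ?_
        change c ≤ m.2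
        subst ht'
        nlinarith
    · rcases extremePoints_convexHull_subset hv with (h | h) | h
      · subst h
        refine ⟨hKM hv.1, ?_⟩
        rintro m hm m' hm' ⟨s, t, hs, ht, hst, h⟩
        obtain ⟨a1, a2, a3⟩ := hMb hm
        obtain ⟨b1, b2, b3⟩ := hMb hm'
        have e1 : s * m.1 + t * m'.1 = 1 := by simpa using congrArg Prod.fst h
        have e2 : s * m.2 + t * m'.2 = 0 := by simpa using congrArg Prod.snd h
        have m2 : m.2 = 0 := by nlinarith [mul_nonneg ht.le b2, mul_nonneg hs.le a2]
        have m2' : m'.2 = 0 := by nlinarith [mul_nonneg ht.le b2, mul_nonneg hs.le a2]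
        have c0 : 0 < c := by linarith
        have n1 : m.1 ≤ 1 := by nlinarith
        have n1' : m'.1 ≤ 1 := by nlinarith
        have ht' : t = 1 - s := by linarith
        ext
        · refine le_antisymm n1 ?_
          change 1 ≤ m.1
          subst ht'
          nlinarith
        · exact m2
      · rw [Set.mem_singleton_iff] at h
        subst h
        refine ⟨hKM hv.1, ?_⟩
        rintro m hm m' hm' ⟨s, t, hs, ht, hst, h⟩
        have a1 := (hMb hm).1
        have b1 := (hMb hm').1
        have e1 : s * m.1 + t * m'.1 = 0 := by simpa using congrArg Prod.fst h
        have e2 : s * m.2 + t * m'.2 = 1 := by simpa using congrArg Prod.snd h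
        have m1 : m.1 = 0 := by nlinarith [mul_nonneg ht.le b1, mul_nonneg hs.le a1]
        have m1' : m'.1 = 0 := by nlinarith [mul_nonneg ht.le b1, mul_nonneg hs.le a1]
        -- points of the hull on the line `x = 0` have height at least one
        have hge {m : ℝ × ℝ} (hm : m ∈ convexHull ℝ (insert (0, c) S)) (h0 : m.1 = 0) :
            1 ≤ m.2 := by
          obtain ⟨w, hw, s, t, hs, ht, hst, h1, h2⟩ := hM hm
          rw [h0] at h1
          rcases mul_eq_zero.1 h1.symm with h | h
          · rw [h, add_zero] at hst
            rw [h2, h, hst]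
            linarith
          · rw [eq_of_fst_eq_zero hY hw h] at h2
            have ht' : t = 1 - s := by linarith
            rw [h2, ht']
            nlinarith
        have g := hge hm m1
        have g' := hge hm' m1'
        have ht' : t = 1 - s := by linarith
        ext
        · exact m1
        · refine le_antisymm ?_ g
          change m.2 ≤ 1
          subst ht'
          nlinarith
      · -- a point strictly below the line: contract the segment towards it
        have hlt := (hY h).2.2
        refine ⟨hKM hv.1, ?_⟩
        rintro m hm m' hm' ⟨s, t, hs, ht, hst, hmm⟩
        have hcont (m : ℝ × ℝ) : ∀ᶠ ε : ℝ in nhdsWithin 0 (Set.Ioi 0),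
            (v + ε • (m - v)).1 + (v + ε • (m - v)).2 < 1 := by
          have hcn : Continuous fun ε : ℝ => (v + ε • (m - v)).1 + (v + ε • (m - v)).2 := by
            fun_prop
          have h0 := hcn.tendsto 0
          simp only [zero_smul, add_zero] at h0
          exact (h0.eventually (gt_mem_nhds hlt)).filter_mono nhdsWithin_le_nhds
        have hsmall : ∀ᶠ ε : ℝ in nhdsWithin 0 (Set.Ioi 0), ε < 1 :=
          (gt_mem_nhds one_pos).filter_mono nhdsWithin_le_nhds
        obtain ⟨ε, ⟨⟨h1, h2⟩, h3⟩, h4⟩ :=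
          (((hcont m).and (hcont m')).and hsmall |>.and self_mem_nhdsWithin).exists
        have h4 : 0 < ε := h4
        have hin {m : ℝ × ℝ} (hm : m ∈ convexHull ℝ (insert (0, c) S))
            (h : (v + ε • (m - v)).1 + (v + ε • (m - v)).2 < 1) :
            v + ε • (m - v) ∈ convexHull ℝ S :=
          hMK ((convex_convexHull ℝ _).add_smul_sub_mem (hKM hv.1) hm ⟨h4.le, h3.le⟩) h.le
        have := hv.2 (hin hm h1) (hin hm' h2) ⟨s, t, hs, ht, hst, ?_⟩
        · have h5 : ε • (m - v) = 0 := by simpa using this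
          exact sub_eq_zero.1 ((smul_eq_zero.1 h5).resolve_left h4.ne')
        · have : s • (v + ε • (m - v)) + t • (v + ε • (m - v + (m' - m))) =
            (s + t) • v + ε • (s • m + t • m' - (s + t) • v) := by
            module
          rw [show m' - v = m - v + (m' - m) by abel, this, hst, hmm]
          simp

end Apex

/-! ### Measurability of the vertex count -/

/-- An extreme point of a convex hull is a generator outside the hull of the other generators. No
finiteness is needed. -/
theorem mem_extremePoints_convexHull_iff {E : Type*} [AddCommGroup E] [Module ℝ E] {S : Set E}
    {v : E} : v ∈ (convexHull ℝ S).extremePoints ℝ ↔ v ∈ S ∧ v ∉ convexHull ℝ (S \ {v}) := by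
  constructor
  · intro hv
    refine ⟨extremePoints_convexHull_subset hv, fun h => ?_⟩
    have hc := ((convex_convexHull ℝ S).mem_extremePoints_iff_convex_sdiff.1 hv).2
    exact (convexHull_min (Set.sdiff_subset_sdiff_left (subset_convexHull ℝ S)) hc h).2 rfl
  · rintro ⟨hS, hv⟩
    refine ⟨subset_convexHull ℝ S hS, ?_⟩
    have hins : S = insert v (S \ {v}) := by simp [Set.insert_eq_of_mem hS]
    rcases (S \ {v}).eq_empty_or_nonempty with he | hne
    · intro m hm m' hm' _
      rw [hins, he, insert_empty_eq, convexHull_singleton] at hm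
      exact hm
    rintro m hm m' hm' ⟨a, b, ha, hb, hab, h⟩
    rw [hins, convexHull_insert hne, convexJoin_singleton_left, Set.mem_iUnion₂] at hm hm'
    obtain ⟨w, hw, s, t, hs, ht, hst, rfl⟩ := hm
    obtain ⟨w', hw', s', t', hs', ht', hst', rfl⟩ := hm'
    have hsum : (a * t) • w + (b * t') • w' = (a * t + b * t') • v := by
      have hs1 : s = 1 - t := by linarith
      have hs1' : s' = 1 - t' := by linarith
      have hb1 : b = 1 - a := by linarith
      subst hs1 hs1' hb1
      rw [← sub_eq_zero] at h ⊢
      rw [← h]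
      module
    rcases (add_nonneg (mul_nonneg ha.le ht) (mul_nonneg hb.le ht')).eq_or_lt with h0 | h0
    · have : a * t = 0 := by
        have := mul_nonneg hb.le ht'
        have := mul_nonneg ha.le ht
        linarith
      have ht0 : t = 0 := (mul_eq_zero.1 this).resolve_left ha.ne'
      rw [ht0, add_zero] at hst
      rw [ht0, hst]
      simp
    · refine absurd ?_ hv
      have := (convex_convexHull ℝ (S \ {v})) hw hw'
        (div_nonneg (mul_nonneg ha.le ht) h0.le) (div_nonneg (mul_nonneg hb.le ht') h0.le)
        (by rw [← add_div, div_self h0.ne'])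
      convert this using 1
      rw [div_eq_inv_mul, div_eq_inv_mul, mul_smul _ (a * t), mul_smul _ (b * t'), ← smul_add,
        hsum, smul_smul, inv_mul_cancel₀ h0.ne', one_smul]

section

variable {ι : Type*} [Fintype ι]

/-- The condition is the projection, along the compact set of convex weights on `J`, of the closed
set of pairs (weights, configuration) whose weighted mean is the `i`-th point. -/
theorem isClosed_mem_convexHull_image (i : ι) (J : Set ι) :
    IsClosed {x : ι → ℝ × ℝ | x i ∈ convexHull ℝ (x '' J)} := by
  classical
  set C : Set (ι → ℝ) := convexHull ℝ ((fun j => Pi.single j (1 : ℝ)) '' J) with hC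
  have hCc : IsCompact C := (J.toFinite.image _).isCompact_convexHull ℝ
  have : CompactSpace C := isCompact_iff_compactSpace.1 hCc
  have heq : {x : ι → ℝ × ℝ | x i ∈ convexHull ℝ (x '' J)} =
      Prod.snd '' {p : C × (ι → ℝ × ℝ) | ∑ j, (p.1 : ι → ℝ) j • p.2 j = p.2 i} := by
    ext x
    have h1 : convexHull ℝ (x '' J) = Fintype.linearCombination ℝ x '' C := by
      rw [hC, LinearMap.image_convexHull, Set.image_image]
      congr 1
      refine Set.image_congr fun j _ => ?_
      simp [Fintype.linearCombination_apply_single]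
    simp only [Set.mem_ofPred_eq, h1, Set.mem_image, Fintype.linearCombination_apply]
    constructor
    · rintro ⟨w, hw, h⟩
      exact ⟨(⟨w, hw⟩, x), h, rfl⟩
    · rintro ⟨⟨w, y⟩, h, rfl⟩
      exact ⟨w, w.2, h⟩
  rw [heq]
  refine isClosedMap_snd_of_compactSpace _ (isClosed_eq ?_ ?_)
  · refine continuous_finsetSum _ fun j _ => ?_
    exact ((continuous_apply j).comp (continuous_subtype_val.comp continuous_fst)).smul
      ((continuous_apply j).comp continuous_snd)
  · fun_prop

theorem measurable_mem_extremePoints (i : ι) : Measurable fun x : ι → ℝ × ℝ =>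
    x i ∈ (convexHull ℝ (Set.range x)).extremePoints ℝ := by
  classical
  -- a finite case distinction over the set `J` of the indices of the points different from `x i`
  have heq : (fun x : ι → ℝ × ℝ => x i ∈ (convexHull ℝ (Set.range x)).extremePoints ℝ) =
      fun x => ∀ J : Finset ι, (∀ j, j ∈ J ↔ x j ≠ x i) →
        x i ∉ convexHull ℝ (x '' (J : Set ι)) := by
    funext x
    rw [eq_iff_iff, mem_extremePoints_convexHull_iff]
    have himg : ∀ J : Finset ι, (∀ j, j ∈ J ↔ x j ≠ x i) →
        Set.range x \ {x i} = x '' (J : Set ι) := by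
      intro J hJ
      ext p
      constructor
      · rintro ⟨⟨j, rfl⟩, h⟩
        exact ⟨j, (hJ j).2 h, rfl⟩
      · rintro ⟨j, hj, rfl⟩
        exact ⟨⟨j, rfl⟩, (hJ j).1 hj⟩
    constructor
    · rintro ⟨-, h⟩ J hJ
      rwa [← himg J hJ]
    · intro h
      have hJ : ∀ j, j ∈ Finset.univ.filter (fun j => x j ≠ x i) ↔ x j ≠ x i := by simp
      refine ⟨⟨i, rfl⟩, ?_⟩
      rw [himg _ hJ]
      exact h _ hJ
  rw [heq]
  refine Measurable.forall fun J => Measurable.imp (Measurable.forall fun j => ?_) ?_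
  · refine Measurable.iff measurable_const (Measurable.not ?_)
    exact measurableSet_setOfPred.1 (measurableSet_eq_fun (measurable_pi_apply j)
      (measurable_pi_apply i))
  · exact (measurableSet_setOfPred.1 (isClosed_mem_convexHull_image i J).measurableSet).not

theorem measurableSet_ncard_extremePoints (m : ℕ) : MeasurableSet {x : ι → ℝ × ℝ |
    ((convexHull ℝ (Set.range x)).extremePoints ℝ).ncard = m} := by
  classical
  -- there are `m` vertices when some `m`-element set `I` of indices lists each of them once
  have heq : {x : ι → ℝ × ℝ | ((convexHull ℝ (Set.range x)).extremePoints ℝ).ncard = m} =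
      {x | ∃ I : Finset ι, I.card = m ∧
        (∀ i, i ∈ I → x i ∈ (convexHull ℝ (Set.range x)).extremePoints ℝ) ∧
        (∀ i j, i ∈ I → j ∈ I → x i = x j → i = j) ∧
        ∀ i, x i ∈ (convexHull ℝ (Set.range x)).extremePoints ℝ → ∃ j, j ∈ I ∧ x j = x i} := by
    ext x
    simp only [Set.mem_ofPred_eq]
    set S := (convexHull ℝ (Set.range x)).extremePoints ℝ with hS
    have hSr : S ⊆ Set.range x := extremePoints_convexHull_subset
    constructor
    · intro h
      obtain ⟨I, hI⟩ := Set.SurjOn.exists_bijOn_subset (f := x) (s := x ⁻¹' S) (t := S)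
        (fun p hp => by
          obtain ⟨i, rfl⟩ := hSr hp
          exact ⟨i, hp, rfl⟩)
      refine ⟨I.toFinite.toFinset, ?_, ?_, ?_, ?_⟩
      · rw [← h, ← hI.2.image_eq, hI.2.injOn.ncard_image, Set.ncard_eq_toFinset_card I]
      · intro i hi
        exact hI.1 (by simpa using hi)
      · intro i j hi hj hij
        exact hI.2.injOn (by simpa using hi) (by simpa using hj) hij
      · intro i hi
        obtain ⟨j, hj, hij⟩ := hI.2.surjOn hi
        exact ⟨j, by simpa using hj, hij⟩
    · rintro ⟨I, hI, h1, h2, h3⟩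
      have : S = x '' (I : Set ι) := by
        apply Set.Subset.antisymm
        · intro p hp
          obtain ⟨i, rfl⟩ := hSr hp
          obtain ⟨j, hj, hij⟩ := h3 i hp
          exact ⟨j, hj, hij⟩
        · rintro _ ⟨i, hi, rfl⟩
          exact h1 i hi
      have hinj : Set.InjOn x (I : Set ι) := fun i hi j hj hij => h2 i j hi hj hij
      rw [this, hinj.ncard_image, Set.ncard_coe_finset, hI]
  rw [heq, measurableSet_setOfPred]
  refine Measurable.exists fun I => Measurable.and measurable_const (Measurable.and ?_
    (Measurable.and ?_ ?_))
  · exact Measurable.forall fun i => Measurable.imp measurable_const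
      (measurable_mem_extremePoints i)
  · exact Measurable.forall fun i => Measurable.forall fun j => Measurable.imp measurable_const <|
      Measurable.imp measurable_const <| Measurable.imp (measurableSet_setOfPred.1
        (measurableSet_eq_fun (measurable_pi_apply i) (measurable_pi_apply j))) measurable_const
  · exact Measurable.forall fun i => Measurable.imp (measurable_mem_extremePoints i) <|
      Measurable.exists fun j => Measurable.and measurable_const (measurableSet_setOfPred.1
        (measurableSet_eq_fun (measurable_pi_apply j) (measurable_pi_apply i)))

theorem measurableSet_hullCount (m : ℕ) :
    MeasurableSet {x : ι → ℝ × ℝ | hullCount (Set.range x) = m} := by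
  have h := measurableSet_ncard_extremePoints (ι := Fin 2 ⊕ ι) m
  have hm : Measurable fun x : ι → ℝ × ℝ =>
      (Sum.elim ![((1 : ℝ), (0 : ℝ)), ((0 : ℝ), (1 : ℝ))] x : Fin 2 ⊕ ι → ℝ × ℝ) := by
    refine measurable_pi_lambda _ fun i => ?_
    cases i with
    | inl i => exact measurable_const
    | inr i => exact measurable_pi_apply i
  convert hm h using 1
  ext x
  simp [hullCount, Set.Sum.elim_range, Set.pair_comm]

end

/-! ### Beta-type integrals over the triangle -/

theorem integral_sub_pow (a : ℝ) (n : ℕ) :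
    ∫ x in (0 : ℝ)..a, (a - x) ^ n = a ^ (n + 1) / (n + 1) := by
  have := intervalIntegral.integral_comp_sub_left (fun x : ℝ => x ^ n) (a := 0) (b := a) a
  rw [this]
  simp

theorem integral_pow_mul_one_sub_pow (j m : ℕ) : ∫ y in (0 : ℝ)..1, y ^ j * (1 - y) ^ m =
    j.factorial * m.factorial / (j + m + 1).factorial := by
  induction j generalizing m with
  | zero =>
    have := integral_sub_pow 1 m
    simp only [pow_zero, one_mul, this, one_pow, Nat.factorial_zero, zero_add, Nat.factorial_succ]
    push_cast
    have : (m.factorial : ℝ) ≠ 0 := by exact_mod_cast m.factorial_ne_zero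
    field_simp
  | succ j ih =>
    have hm : (m : ℝ) + 1 ≠ 0 := by positivity
    have h := intervalIntegral.integral_mul_deriv_eq_deriv_mul (a := 0) (b := 1)
      (u := fun y : ℝ => y ^ (j + 1)) (v := fun y : ℝ => -((1 - y) ^ (m + 1) / (m + 1)))
      (u' := fun y => (j + 1) * y ^ j) (v' := fun y => (1 - y) ^ m)
      (fun y _ => by simpa using hasDerivAt_pow (j + 1) y)
      (fun y _ => by
        have := (((hasDerivAt_id y).const_sub 1).pow (m + 1)).div_const ((m : ℝ) + 1) |>.neg
        refine HasDerivAt.congr_deriv this ?_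
        push_cast
        simp only [id]
        field_simp)
      (Continuous.intervalIntegrable (by fun_prop) _ _)
      (Continuous.intervalIntegrable (by fun_prop) _ _)
    rw [h]
    have h2 : ∀ y : ℝ, (j + 1) * y ^ j * -((1 - y) ^ (m + 1) / (m + 1)) =
        -((j + 1) / (m + 1)) * (y ^ j * (1 - y) ^ (m + 1)) := fun y => by
      field_simp
    simp only [h2, intervalIntegral.integral_const_mul, ih]
    rw [show j + (m + 1) + 1 = j + 1 + m + 1 by ring, Nat.factorial_succ j, Nat.factorial_succ m]
    push_cast
    simp
    field_simp

theorem lintegral_Ioo_ofReal {a : ℝ} (ha : 0 ≤ a) {g : ℝ → ℝ} (hg : Continuous g)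
    (h0 : ∀ x, 0 < x → x < a → 0 ≤ g x) :
    ∫⁻ x in Set.Ioo 0 a, ENNReal.ofReal (g x) = ENNReal.ofReal (∫ x in (0 : ℝ)..a, g x) := by
  rw [intervalIntegral.integral_of_le ha, integral_Ioc_eq_integral_Ioo,
    ofReal_integral_eq_lintegral_ofReal]
  · exact (hg.integrableOn_Icc (a := 0) (b := a)).mono_set Set.Ioo_subset_Icc_self
  · exact (ae_restrict_iff' measurableSet_Ioo).2 (Filter.Eventually.of_forall fun x hx =>
      h0 x hx.1 hx.2)

theorem measurableSet_openTriangle : MeasurableSet openTriangle := by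
  have : IsOpen openTriangle := by
    have h1 : IsOpen {p : ℝ × ℝ | 0 < p.1} := isOpen_lt continuous_const continuous_fst
    have h2 : IsOpen {p : ℝ × ℝ | 0 < p.2} := isOpen_lt continuous_const continuous_snd
    have h3 : IsOpen {p : ℝ × ℝ | p.1 + p.2 < 1} := isOpen_lt (by fun_prop) continuous_const
    exact h1.inter (h2.inter h3)
  exact this.measurableSet

/-- The inner integral over `x` is elementary, and the outer one over `y` is a beta integral. -/
theorem lintegral_openTriangle {n j : ℕ} (hj : j ≤ n) :
    ∫⁻ p in openTriangle, ENNReal.ofReal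
      ((p.2 * (1 - p.1 - p.2) / (1 - p.2)) ^ j * (1 - p.1 - p.2) ^ (n - j)) =
    ENNReal.ofReal (j.factorial * (n + 1 - j).factorial / ((n + 1) * (n + 2).factorial)) := by
  rw [← lintegral_indicator measurableSet_openTriangle, Measure.volume_eq_prod,
    lintegral_prod_symm']
  swap
  · refine Measurable.indicator ?_ measurableSet_openTriangle
    fun_prop
  have hinner (y : ℝ) : ∫⁻ x, openTriangle.indicator (fun p => ENNReal.ofReal
      ((p.2 * (1 - p.1 - p.2) / (1 - p.2)) ^ j * (1 - p.1 - p.2) ^ (n - j))) (x, y) =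
      (Set.Ioo (0 : ℝ) 1).indicator
        (fun y => ENNReal.ofReal (1 / (n + 1) * (y ^ j * (1 - y) ^ (n + 1 - j)))) y := by
    by_cases hy : y ∈ Set.Ioo (0 : ℝ) 1
    · rw [Set.indicator_of_mem hy]
      have hy1 : 0 < 1 - y := by linarith [hy.2]
      have h1 : (fun x => openTriangle.indicator (fun p => ENNReal.ofReal
          ((p.2 * (1 - p.1 - p.2) / (1 - p.2)) ^ j * (1 - p.1 - p.2) ^ (n - j))) (x, y)) =
          (Set.Ioo 0 (1 - y)).indicator
            fun x => ENNReal.ofReal ((y / (1 - y)) ^ j * ((1 - y) - x) ^ n) := by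
        funext x
        by_cases hx : x ∈ Set.Ioo 0 (1 - y)
        · have hp : (x, y) ∈ openTriangle := ⟨hx.1, hy.1, by
            change x + y < 1
            linarith [hx.2]⟩
          rw [Set.indicator_of_mem hx, Set.indicator_of_mem hp]
          congr 1
          change (y * (1 - x - y) / (1 - y)) ^ j * (1 - x - y) ^ (n - j) = _
          rw [show y * (1 - x - y) / (1 - y) = y / (1 - y) * (1 - y - x) by ring, mul_pow,
            mul_assoc, show 1 - x - y = 1 - y - x by ring, ← pow_add, Nat.add_sub_cancel' hj]
        · rw [Set.indicator_of_notMem hx, Set.indicator_of_notMem]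
          intro hp
          have h3 : x + y < 1 := hp.2.2
          exact hx ⟨hp.1, by linarith⟩
      rw [h1, lintegral_indicator measurableSet_Ioo, lintegral_Ioo_ofReal hy1.le (by fun_prop)
        (fun x _ hx => mul_nonneg (pow_nonneg (div_nonneg hy.1.le hy1.le) _)
          (pow_nonneg (by linarith) _)), intervalIntegral.integral_const_mul, integral_sub_pow]
      congr 1
      rw [show n + 1 = j + (n + 1 - j) by omega, pow_add, div_pow]
      have : (1 - y) ^ j ≠ 0 := pow_ne_zero _ hy1.ne'
      rw [show j + (n + 1 - j) - j = n + 1 - j by omega]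
      field_simp
    · rw [Set.indicator_of_notMem hy]
      refine (lintegral_congr fun x => ?_).trans lintegral_zero
      refine Set.indicator_of_notMem (fun hp => hy ⟨hp.2.1, ?_⟩) _
      have h1 : 0 < x := hp.1
      have h3 : x + y < 1 := hp.2.2
      linarith
  simp only [hinner]
  rw [lintegral_indicator measurableSet_Ioo, lintegral_Ioo_ofReal zero_le_one (by fun_prop)
    (fun y h0 h1 => by have := sub_nonneg.2 h1.le; positivity),
    intervalIntegral.integral_const_mul, integral_pow_mul_one_sub_pow,
    show j + (n + 1 - j) + 1 = n + 2 by omega]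
  congr 1
  field_simp

/-! ### The uniform distribution on the triangle -/

theorem volume_line_eq_zero {a b c : ℝ} (h : a ≠ 0 ∨ b ≠ 0) :
    volume {p : ℝ × ℝ | a * p.1 + b * p.2 = c} = 0 := by
  have key (a b c : ℝ) (hb : b ≠ 0) : volume {p : ℝ × ℝ | a * p.1 + b * p.2 = c} = 0 := by
    rw [Measure.volume_eq_prod, Measure.measure_prod_null (measurableSet_eq_fun
      (by fun_prop) measurable_const)]
    refine Filter.Eventually.of_forall fun x => ?_
    refine measure_mono_null (t := {(c - a * x) / b}) (fun y hy => ?_) (by simp)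
    have : a * x + b * y = c := hy
    rw [Set.mem_singleton_iff, eq_div_iff hb]
    linarith
  rcases h with h | h
  · have h1 := (Measure.measurePreserving_swap (μ := (volume : Measure ℝ))
      (ν := (volume : Measure ℝ))).measure_preimage
      (s := {p : ℝ × ℝ | a * p.1 + b * p.2 = c})
      (measurableSet_eq_fun (by fun_prop) measurable_const).nullMeasurableSet
    rw [Measure.volume_eq_prod, ← h1, ← key b a c h, Measure.volume_eq_prod]
    congr 1
    ext p
    simp [add_comm]
  · exact key a b c h

theorem triangle_eq : triangle = {p : ℝ × ℝ | 0 ≤ p.1 ∧ 0 ≤ p.2 ∧ p.1 + p.2 ≤ 1} := by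
  apply Set.Subset.antisymm
  · refine convexHull_min ?_ ?_
    · rintro p (rfl | rfl | rfl) <;> norm_num
    · rintro ⟨a, b⟩ ⟨h1, h2, h3⟩ ⟨a', b'⟩ ⟨h1', h2', h3'⟩ s t hs ht hst
      simp only [Set.mem_ofPred_eq, Prod.smul_mk, Prod.mk_add_mk, smul_eq_mul] at *
      refine ⟨by positivity, by positivity, ?_⟩
      nlinarith
  · rintro ⟨a, b⟩ ⟨h1, h2, h3⟩
    have hc : Convex ℝ triangle := convex_convexHull ℝ _
    have m0 : ((0 : ℝ), (0 : ℝ)) ∈ triangle := subset_convexHull ℝ _ (by simp)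
    have m1 : ((1 : ℝ), (0 : ℝ)) ∈ triangle := subset_convexHull ℝ _ (by simp)
    have m2 : ((0 : ℝ), (1 : ℝ)) ∈ triangle := subset_convexHull ℝ _ (by simp)
    have := hc.sum_mem (t := Finset.univ) (w := ![1 - a - b, a, b])
      (z := ![((0 : ℝ), (0 : ℝ)), ((1 : ℝ), (0 : ℝ)), ((0 : ℝ), (1 : ℝ))])
      (fun i _ => by fin_cases i <;> simp_all; linarith)
      (by simp [Fin.sum_univ_three]; ring) (fun i _ => by fin_cases i <;> simpa)
    simpa [Fin.sum_univ_three] using this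

theorem triangle_ae_eq : (triangle : Set (ℝ × ℝ)) =ᵐ[volume] openTriangle := by
  refine Filter.EventuallyLE.antisymm ?_ (Filter.Eventually.of_forall fun p hp => ?_)
  · rw [ae_le_set]
    refine measure_mono_null (t := {p : ℝ × ℝ | 1 * p.1 + 0 * p.2 = 0} ∪
      ({p : ℝ × ℝ | 0 * p.1 + 1 * p.2 = 0} ∪ {p : ℝ × ℝ | 1 * p.1 + 1 * p.2 = 1})) ?_ ?_
    · rintro p ⟨hp, hp'⟩
      rw [triangle_eq] at hp
      obtain ⟨h1, h2, h3⟩ := hp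
      by_contra h
      simp only [Set.mem_union, Set.mem_ofPred_eq, one_mul, zero_mul, add_zero, zero_add,
        not_or] at h
      exact hp' ⟨lt_of_le_of_ne h1 (Ne.symm h.1), lt_of_le_of_ne h2 (Ne.symm h.2.1),
        lt_of_le_of_ne h3 h.2.2⟩
    · exact measure_union_null (volume_line_eq_zero (by simp))
        (measure_union_null (volume_line_eq_zero (by simp)) (volume_line_eq_zero (by simp)))
  · have hp' : p ∈ openTriangle := hp
    have : p ∈ triangle := by
      rw [triangle_eq]
      exact ⟨hp'.1.le, hp'.2.1.le, hp'.2.2.le⟩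
    exact this

theorem volume_openTriangle : volume openTriangle = 2⁻¹ := by
  have := lintegral_openTriangle (le_refl 0)
  simp only [pow_zero, mul_one, ENNReal.ofReal_one, lintegral_one, Measure.restrict_apply_univ,
    Nat.sub_zero] at this
  rw [this, ← ENNReal.ofReal_ofNat 2, ← ENNReal.ofReal_inv_of_pos two_pos]
  norm_num [Nat.factorial]

theorem uniformTriangle_eq : uniformTriangle = (2 : ENNReal) • volume.restrict openTriangle := by
  rw [uniformTriangle, ProbabilityTheory.cond, measure_congr triangle_ae_eq, volume_openTriangle,
    Measure.restrict_congr_set triangle_ae_eq, inv_inv]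

instance : IsProbabilityMeasure uniformTriangle := by
  refine ⟨?_⟩
  rw [uniformTriangle_eq]
  simp [volume_openTriangle, ENNReal.mul_inv_cancel]

theorem uniformTriangle_apply (s : Set (ℝ × ℝ)) :
    uniformTriangle s = 2 * volume (s ∩ openTriangle) := by
  rw [uniformTriangle_eq, Measure.smul_apply, Measure.restrict_apply' measurableSet_openTriangle,
    smul_eq_mul]

theorem uniformTriangle_absolutelyContinuous : uniformTriangle ≪ volume := by
  rw [uniformTriangle_eq]
  exact (Measure.restrict_le_self.absolutelyContinuous).smul_left _

theorem ae_mem_openTriangle : ∀ᵐ p ∂uniformTriangle, p ∈ openTriangle := by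
  rw [ae_iff, uniformTriangle_apply]
  have : {p | p ∉ openTriangle} ∩ openTriangle = ∅ := by
    ext p
    simp
  simp [this]

/-! ### Affine maps of the plane -/

/-- The affine map `(x, y) ↦ (a x + b y + e, c x + d y + f)`. -/
noncomputable def planeMap (a b c d e f : ℝ) : ℝ × ℝ →ᵃ[ℝ] ℝ × ℝ :=
  (Matrix.toLin (Module.Basis.finTwoProd ℝ) (Module.Basis.finTwoProd ℝ) !![a, b; c, d]).toAffineMap
    + AffineMap.const ℝ (ℝ × ℝ) (e, f)

theorem planeMap_apply (a b c d e f : ℝ) (p : ℝ × ℝ) :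
    planeMap a b c d e f p = (a * p.1 + b * p.2 + e, c * p.1 + d * p.2 + f) := by
  simp [planeMap, Matrix.toLin_finTwoProd_apply]

theorem planeMap_bijective {a b c d e f : ℝ} (h : a * d - b * c ≠ 0) :
    Function.Bijective (planeMap a b c d e f) := by
  constructor
  · rintro ⟨x, y⟩ ⟨x', y'⟩ heq
    rw [planeMap_apply, planeMap_apply, Prod.mk.injEq] at heq
    obtain ⟨h1, h2⟩ := heq
    simp only at h1 h2
    refine Prod.ext (mul_left_cancel₀ h ?_) (mul_left_cancel₀ h ?_)
    · linear_combination d * h1 - b * h2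
    · linear_combination a * h2 - c * h1
  · rintro ⟨u, v⟩
    refine ⟨((d * (u - e) - b * (v - f)) / (a * d - b * c),
      (a * (v - f) - c * (u - e)) / (a * d - b * c)), ?_⟩
    obtain ⟨Δ, hΔ⟩ : ∃ Δ, Δ = a * d - b * c := ⟨_, rfl⟩
    rw [planeMap_apply, ← hΔ]
    rw [← hΔ] at h
    ext
    · simp only
      field_simp
      rw [hΔ]
      ring
    · simp only
      field_simp
      rw [hΔ]
      ring

theorem measurable_planeMap (a b c d e f : ℝ) : Measurable (planeMap a b c d e f) := by
  have : (planeMap a b c d e f : ℝ × ℝ → ℝ × ℝ) =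
      fun p => (a * p.1 + b * p.2 + e, c * p.1 + d * p.2 + f) := funext (planeMap_apply a b c d e f)
  rw [this]
  fun_prop

theorem volume_preimage_planeMap {a b c d e f : ℝ} (h : a * d - b * c ≠ 0) (s : Set (ℝ × ℝ)) :
    volume (planeMap a b c d e f ⁻¹' s) = ENNReal.ofReal |(a * d - b * c)⁻¹| * volume s := by
  set L := Matrix.toLin (Module.Basis.finTwoProd ℝ) (Module.Basis.finTwoProd ℝ)
    !![a, b; c, d] with hL
  have hdet : LinearMap.det L = a * d - b * c := by
    rw [hL, LinearMap.det_toLin, Matrix.det_fin_two_of]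
  have hpre : planeMap a b c d e f ⁻¹' s = L ⁻¹' ((fun p => p + (e, f)) ⁻¹' s) := rfl
  rw [hpre, Measure.addHaar_preimage_linearMap _ (hdet ▸ h), hdet, measure_preimage_add_right]

/-- If the affine map `f` maps the open triangle onto the part `R` of it, then the uniform
distribution restricted to `R` is a multiple of its image under `f`. -/
theorem restrict_uniformTriangle_eq {a b c d e f : ℝ} (h : 0 < a * d - b * c)
    {R : Set (ℝ × ℝ)} (hRT : R ⊆ openTriangle)
    (hmem : ∀ p, planeMap a b c d e f p ∈ R ↔ p ∈ openTriangle) :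
    uniformTriangle.restrict R =
      ENNReal.ofReal (a * d - b * c) • uniformTriangle.map (planeMap a b c d e f) := by
  ext s hs
  rw [Measure.restrict_apply hs, Measure.smul_apply,
    Measure.map_apply (measurable_planeMap a b c d e f) hs, uniformTriangle_apply,
    uniformTriangle_apply, Set.inter_assoc, Set.inter_eq_left.2 hRT]
  have : planeMap a b c d e f ⁻¹' s ∩ openTriangle = planeMap a b c d e f ⁻¹' (s ∩ R) := by
    ext p
    simp [hmem]
  rw [this, volume_preimage_planeMap h.ne', smul_eq_mul, abs_of_pos (inv_pos.2 h),
    mul_left_comm 2, ← mul_assoc (ENNReal.ofReal _), ← ENNReal.ofReal_mul h.le,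
    mul_inv_cancel₀ h.ne', ENNReal.ofReal_one, one_mul]

/-! ### Splitting the chain at its first point -/

/-- The line through `(0,1)` and `P` meets the `x`-axis strictly to the left of the line through
`(0,1)` and `q`: the point `P` comes before `q` on the way round `(0,1)`. -/
def Before (P q : ℝ × ℝ) : Prop := P.1 * (1 - q.2) < q.1 * (1 - P.2)

/-- The part of the open triangle that comes after `P` and lies below the line through `P` and
`(1,0)`. -/
def lowerPart (P : ℝ × ℝ) : Set (ℝ × ℝ) :=
  {q | q ∈ openTriangle ∧ Before P q ∧ q.2 * (1 - P.1) < P.2 * (1 - q.1)}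

/-- The part of the open triangle that comes after `P` and lies above the line through `P` and
`(1,0)`: the interior of the triangle `(0,1)`, `P`, `(1,0)`. -/
def upperPart (P : ℝ × ℝ) : Set (ℝ × ℝ) :=
  {q | q ∈ openTriangle ∧ Before P q ∧ P.2 * (1 - q.1) < q.2 * (1 - P.1)}

/-- The abscissa of the intersection of the `x`-axis and the line through `(0,1)` and `P`. -/
noncomputable def foot (P : ℝ × ℝ) : ℝ := P.1 / (1 - P.2)

/-- The affine map that fixes `(1,0)`, and maps `(0,1)` to `P` and the origin to `(foot P, 0)`. -/
noncomputable def lowerMap (P : ℝ × ℝ) : ℝ × ℝ →ᵃ[ℝ] ℝ × ℝ :=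
  planeMap (1 - foot P) (P.1 - foot P) 0 P.2 (foot P) 0

/-- The affine map that fixes `(1,0)` and `(0,1)`, and maps the origin to `P`. -/
noncomputable def upperMap (P : ℝ × ℝ) : ℝ × ℝ →ᵃ[ℝ] ℝ × ℝ :=
  planeMap (1 - P.1) (-P.1) (-P.2) (1 - P.2) P.1 P.2

variable {P : ℝ × ℝ}

theorem foot_pos (hP : P ∈ openTriangle) : 0 < foot P :=
  div_pos hP.1 (by linarith [hP.1, hP.2.2])

theorem foot_lt_one (hP : P ∈ openTriangle) : foot P < 1 := by
  rw [foot, div_lt_one (by linarith [hP.1, hP.2.2])]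
  linarith [hP.2.2]

theorem foot_mul (hP : P ∈ openTriangle) : foot P * (1 - P.2) = P.1 :=
  div_mul_cancel₀ _ (by linarith [hP.1, hP.2.2])

theorem lowerMap_det_pos (hP : P ∈ openTriangle) :
    0 < (1 - foot P) * P.2 - (P.1 - foot P) * 0 := by
  rw [mul_zero, sub_zero]
  exact mul_pos (sub_pos.2 (foot_lt_one hP)) hP.2.1

theorem upperMap_det_pos (hP : P ∈ openTriangle) :
    0 < (1 - P.1) * (1 - P.2) - (-P.1) * (-P.2) := by
  have := hP.2.2
  nlinarith

theorem lowerMap_bijective (hP : P ∈ openTriangle) : Function.Bijective (lowerMap P) :=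
  planeMap_bijective (lowerMap_det_pos hP).ne'

theorem measurable_lowerMap (P : ℝ × ℝ) : Measurable (lowerMap P) :=
  measurable_planeMap _ _ _ _ _ _

theorem lowerMap_mem_lowerPart_iff (hP : P ∈ openTriangle) (p : ℝ × ℝ) :
    lowerMap P p ∈ lowerPart P ↔ p ∈ openTriangle := by
  have ht := foot_lt_one hP
  have ht0 := foot_pos hP
  have htm := foot_mul hP
  set t := foot P
  obtain ⟨h1, h2, h3⟩ := hP
  obtain ⟨a, b⟩ := p
  have hy : 0 < 1 - P.2 := by linarith
  have hD : 0 < 1 - P.1 - P.2 := by linarith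
  rw [lowerMap, planeMap_apply]
  have e1 : ((1 - t) * a + (P.1 - t) * b + t) * (1 - P.2) -
      P.1 * (1 - (0 * a + P.2 * b + 0)) = a * (1 - P.1 - P.2) := by
    linear_combination (1 - a - b) * htm
  have e2 : (1 - P.2) * (P.2 * (1 - ((1 - t) * a + (P.1 - t) * b + t)) -
      (0 * a + P.2 * b + 0) * (1 - P.1)) = P.2 * (1 - P.1 - P.2) * (1 - a - b) := by
    linear_combination -P.2 * (1 - a - b) * htm
  have e3 : (1 - t) * a + (P.1 - t) * b + t = t * (1 - a - b) + a + b * P.1 := by ring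
  have e4 : 1 - (((1 - t) * a + (P.1 - t) * b + t) + (0 * a + P.2 * b + 0)) =
      (1 - a - b) * (1 - t) + b * (1 - P.1 - P.2) := by ring
  constructor
  · rintro ⟨⟨-, q2, -⟩, q4, q5⟩
    simp only [Before] at q2 q4 q5
    refine ⟨?_, ?_, ?_⟩
    · have : 0 < a * (1 - P.1 - P.2) := by rw [← e1]; linarith
      exact pos_of_mul_pos_left this hD.le
    · have : 0 < P.2 * b := by linarith
      exact pos_of_mul_pos_right this h2.le
    · have : 0 < P.2 * (1 - P.1 - P.2) * (1 - a - b) := by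
        rw [← e2]
        exact mul_pos hy (by linarith)
      have := pos_of_mul_pos_right this (by positivity)
      change a + b < 1
      linarith
  · rintro ⟨ha, hb, hab⟩
    simp only at ha hb hab
    have hab' : 0 < 1 - a - b := by linarith
    refine ⟨⟨?_, ?_, ?_⟩, ?_, ?_⟩
    · change 0 < (1 - t) * a + (P.1 - t) * b + t
      rw [e3]
      positivity
    · change 0 < 0 * a + P.2 * b + 0
      have := mul_pos h2 hb
      linarith
    · have : 0 < (1 - a - b) * (1 - t) + b * (1 - P.1 - P.2) :=
        add_pos (mul_pos hab' (by linarith)) (mul_pos hb hD)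
      rw [← e4] at this
      simp only
      linarith
    · have := mul_pos ha hD
      rw [← e1] at this
      simp only [Before]
      linarith
    · have : 0 < P.2 * (1 - P.1 - P.2) * (1 - a - b) := by positivity
      rw [← e2] at this
      have := pos_of_mul_pos_right this hy.le
      simp only
      linarith

theorem upperMap_mem_upperPart_iff (hP : P ∈ openTriangle) (p : ℝ × ℝ) :
    upperMap P p ∈ upperPart P ↔ p ∈ openTriangle := by
  obtain ⟨h1, h2, h3⟩ := hP
  obtain ⟨a, b⟩ := p
  have hD : 0 < 1 - P.1 - P.2 := by linarith
  rw [upperMap, planeMap_apply]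
  have e1 : ((1 - P.1) * a + -P.1 * b + P.1) * (1 - P.2) -
      P.1 * (1 - (-P.2 * a + (1 - P.2) * b + P.2)) = a * (1 - P.1 - P.2) := by ring
  have e2 : (-P.2 * a + (1 - P.2) * b + P.2) * (1 - P.1) -
      P.2 * (1 - ((1 - P.1) * a + -P.1 * b + P.1)) = b * (1 - P.1 - P.2) := by ring
  have e3 : 1 - (((1 - P.1) * a + -P.1 * b + P.1) + (-P.2 * a + (1 - P.2) * b + P.2)) =
      (1 - a - b) * (1 - P.1 - P.2) := by ring
  constructor
  · rintro ⟨⟨-, -, q3⟩, q4, q5⟩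
    simp only [Before] at q3 q4 q5
    refine ⟨?_, ?_, ?_⟩
    · have : 0 < a * (1 - P.1 - P.2) := by rw [← e1]; linarith
      exact pos_of_mul_pos_left this hD.le
    · have : 0 < b * (1 - P.1 - P.2) := by rw [← e2]; linarith
      exact pos_of_mul_pos_left this hD.le
    · have : 0 < (1 - a - b) * (1 - P.1 - P.2) := by rw [← e3]; linarith
      have := pos_of_mul_pos_left this hD.le
      change a + b < 1
      linarith
  · rintro ⟨ha, hb, hab⟩
    simp only at ha hb hab
    have hab' : 0 < 1 - a - b := by linarith
    refine ⟨⟨?_, ?_, ?_⟩, ?_, ?_⟩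
    · change 0 < (1 - P.1) * a + -P.1 * b + P.1
      nlinarith [mul_pos h1 hab']
    · change 0 < -P.2 * a + (1 - P.2) * b + P.2
      nlinarith [mul_pos h2 hab']
    · have := mul_pos hab' hD
      rw [← e3] at this
      simp only
      linarith
    · have := mul_pos ha hD
      rw [← e1] at this
      simp only [Before]
      linarith
    · have := mul_pos hb hD
      rw [← e2] at this
      simp only
      linarith

theorem upperPart_subset_convexHull (hP : P ∈ openTriangle) :
    upperPart P ⊆ convexHull ℝ {((1 : ℝ), (0 : ℝ)), ((0 : ℝ), (1 : ℝ)), P} := by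
  intro q hq
  obtain ⟨p, rfl⟩ :=
    (planeMap_bijective (e := P.1) (f := P.2) (upperMap_det_pos hP).ne').2 q
  have hp : p ∈ openTriangle := (upperMap_mem_upperPart_iff hP p).1 hq
  have m1 : ((1 : ℝ), (0 : ℝ)) ∈ convexHull ℝ {((1 : ℝ), (0 : ℝ)), ((0 : ℝ), (1 : ℝ)), P} :=
    subset_convexHull ℝ _ (by simp)
  have m2 : ((0 : ℝ), (1 : ℝ)) ∈ convexHull ℝ {((1 : ℝ), (0 : ℝ)), ((0 : ℝ), (1 : ℝ)), P} :=
    subset_convexHull ℝ _ (by simp)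
  have m0 : P ∈ convexHull ℝ {((1 : ℝ), (0 : ℝ)), ((0 : ℝ), (1 : ℝ)), P} :=
    subset_convexHull ℝ _ (by simp)
  obtain ⟨a, b⟩ := p
  have := (convex_convexHull ℝ {((1 : ℝ), (0 : ℝ)), ((0 : ℝ), (1 : ℝ)), P}).sum_mem
    (t := Finset.univ) (w := ![1 - a - b, a, b])
    (z := ![P, ((1 : ℝ), (0 : ℝ)), ((0 : ℝ), (1 : ℝ))])
    (fun i _ => by
      have h1 := hp.1
      have h2 := hp.2.1
      have h3 := hp.2.2
      simp only at h1 h2 h3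
      fin_cases i
      · change 0 ≤ 1 - a - b
        linarith
      · exact h1.le
      · exact h2.le)
    (by simp [Fin.sum_univ_three]; ring) (fun i _ => by fin_cases i <;> assumption)
  convert this using 1
  rw [planeMap_apply]
  simp only [Fin.sum_univ_three, Matrix.cons_val_zero, Matrix.cons_val_one, Matrix.cons_val]
  ext
  · simp
    ring
  · simp
    ring

/-- The first point of the chain is a vertex, the points above it are not, and the other vertices
are those of the chain below it. -/
theorem hullCount_insert (hP : P ∈ openTriangle) {Y Q : Set (ℝ × ℝ)} (hYf : Y.Finite)
    (hY : Y ⊆ openTriangle) (hQ : Q ⊆ upperPart P) :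
    hullCount (insert P (lowerMap P '' Y ∪ Q)) = hullCount Y + 1 := by
  -- `lowerMap P` maps the apex `(0, 1 / P.2)` to `(0,1)`, and `(0,1)` to `P`
  have hc : 1 < 1 / P.2 := by
    rw [lt_div_iff₀ hP.2.1]
    linarith [hP.1, hP.2.2]
  set S : Set (ℝ × ℝ) := {((1 : ℝ), (0 : ℝ)), ((0 : ℝ), (1 : ℝ))} ∪ Y with hS
  have hinj : Function.Injective (lowerMap P) := (lowerMap_bijective hP).1
  have htm := foot_mul hP
  have hP2 := hP.2.1.ne'
  have himg : lowerMap P '' (insert (0, 1 / P.2) S) =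
      insert (0, 1) (insert (1, 0) (insert P (lowerMap P '' Y))) := by
    have e1 : lowerMap P (0, 1 / P.2) = (0, 1) := by
      rw [lowerMap, planeMap_apply]
      ext
      · simp only
        field_simp
        linear_combination -htm
      · simp only
        field_simp
        ring
    have e2 : lowerMap P (1, 0) = (1, 0) := by
      rw [lowerMap, planeMap_apply]
      ext <;> simp
    have e3 : lowerMap P (0, 1) = P := by
      rw [lowerMap, planeMap_apply]
      ext <;> simp
    rw [hS, Set.image_insert_eq, Set.image_union, Set.image_pair, e1, e2, e3]
    simp [Set.insert_union]
  have hhull : convexHull ℝ ({((1 : ℝ), (0 : ℝ)), ((0 : ℝ), (1 : ℝ))} ∪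
      insert P (lowerMap P '' Y ∪ Q)) = lowerMap P '' convexHull ℝ (insert (0, 1 / P.2) S) := by
    rw [AffineMap.image_convexHull, himg]
    apply Set.Subset.antisymm
    · refine convexHull_min ?_ (convex_convexHull ℝ _)
      rintro q ((rfl | rfl) | rfl | hq | hq)
      · exact subset_convexHull ℝ _ (by simp)
      · exact subset_convexHull ℝ _ (by simp)
      · exact subset_convexHull ℝ _ (by simp)
      · exact subset_convexHull ℝ _ (by simp [hq])
      · refine convexHull_mono ?_ (upperPart_subset_convexHull hP (hQ hq))
        rintro p (rfl | rfl | rfl) <;> simp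
    · refine convexHull_mono ?_
      rintro q (rfl | rfl | rfl | hq)
      · simp
      · simp
      · simp
      · exact Or.inr (Or.inr (Or.inl hq))
  have hfin : ((convexHull ℝ S).extremePoints ℝ).Finite :=
    (((Set.finite_singleton _).insert _).union hYf).subset extremePoints_convexHull_subset
  rw [hullCount, hhull, image_extremePoints_of_injective _ hinj,
    Set.ncard_image_of_injective _ hinj,
    extremePoints_insert_apex hY hc, Set.ncard_insert_of_notMem ?_ hfin, hullCount]
  intro h
  have := (convexHull_base_subset hY h.1).2.2
  simp only [zero_add] at this
  linarith

/-- A nonempty chain has a vertex besides the two end points. -/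
theorem hullCount_ne_two {Y : Set (ℝ × ℝ)} (hYf : Y.Finite) (hYne : Y.Nonempty)
    (hY : Y ⊆ openTriangle) : hullCount Y ≠ 2 := by
  set S : Set (ℝ × ℝ) := {((1 : ℝ), (0 : ℝ)), ((0 : ℝ), (1 : ℝ))} ∪ Y with hS
  have hSf : S.Finite := ((Set.finite_singleton _).insert _).union hYf
  have h1 : ((1 : ℝ), (0 : ℝ)) ∈ (convexHull ℝ S).extremePoints ℝ := by
    refine mem_extremePoints_convexHull_iff.2 ⟨by simp [hS], fun h => ?_⟩
    have hc : Convex ℝ {w : ℝ × ℝ | w.1 < 1} := convex_halfSpace_lt (LinearMap.fst ℝ ℝ ℝ).isLinear 1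
    have : (1 : ℝ) < 1 := convexHull_min (s := S \ {((1 : ℝ), (0 : ℝ))}) (fun p hp => by
      rcases hp with ⟨(rfl | rfl) | hp, hp'⟩
      · exact absurd rfl hp'
      · simp
      · have h1 := (hY hp).2.1
        have h2 := (hY hp).2.2
        change p.1 < 1
        linarith) hc h
    exact lt_irrefl _ this
  have h2 : ((0 : ℝ), (1 : ℝ)) ∈ (convexHull ℝ S).extremePoints ℝ := by
    refine mem_extremePoints_convexHull_iff.2 ⟨by simp [hS], fun h => ?_⟩
    have hc : Convex ℝ {w : ℝ × ℝ | w.2 < 1} := convex_halfSpace_lt (LinearMap.snd ℝ ℝ ℝ).isLinear 1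
    have : (1 : ℝ) < 1 := convexHull_min (s := S \ {((0 : ℝ), (1 : ℝ))}) (fun p hp => by
      rcases hp with ⟨(rfl | rfl) | hp, hp'⟩
      · simp
      · exact absurd rfl hp'
      · have h1 := (hY hp).1
        have h2 := (hY hp).2.2
        change p.2 < 1
        linarith) hc h
    exact lt_irrefl _ this
  intro hcount
  have hfin : ((convexHull ℝ S).extremePoints ℝ).Finite :=
    hSf.subset extremePoints_convexHull_subset
  have hext : ({((1 : ℝ), (0 : ℝ)), ((0 : ℝ), (1 : ℝ))} : Set (ℝ × ℝ)) =
      (convexHull ℝ S).extremePoints ℝ := by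
    refine Set.eq_of_subset_of_ncard_le ?_ ?_ hfin
    · rintro p (rfl | rfl)
      · exact h1
      · exact h2
    · rw [Set.ncard_pair (by simp)]
      exact hcount.le
  -- by the Krein–Milman theorem the hull would be contained in the half-plane `1 ≤ x + y`
  have hKM := closure_convexHull_extremePoints (hSf.isCompact_convexHull ℝ) (convex_convexHull ℝ S)
  rw [← hext] at hKM
  obtain ⟨p, hp⟩ := hYne
  have hpK : p ∈ convexHull ℝ S := subset_convexHull ℝ _ (Or.inr hp)
  rw [← hKM] at hpK
  have hc : Convex ℝ {w : ℝ × ℝ | 1 ≤ w.1 + w.2} :=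
    convex_halfSpace_ge (LinearMap.fst ℝ ℝ ℝ + LinearMap.snd ℝ ℝ ℝ).isLinear 1
  have hcl : IsClosed {w : ℝ × ℝ | 1 ≤ w.1 + w.2} := isClosed_le continuous_const (by fun_prop)
  have : 1 ≤ p.1 + p.2 := closure_minimal (convexHull_min (by
    rintro q (rfl | rfl) <;> simp) hc) hcl hpK
  linarith [(hY hp).2.2]

/-! ### The law of the vertex count, given the first point -/

theorem measurableSet_before : MeasurableSet {p : (ℝ × ℝ) × (ℝ × ℝ) | Before p.1 p.2} :=
  measurableSet_lt (by fun_prop) (by fun_prop)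

theorem measurableSet_lowerPart (P : ℝ × ℝ) : MeasurableSet (lowerPart P) := by
  have h1 : MeasurableSet {q | Before P q} := measurable_prodMk_left (x := P) measurableSet_before
  have h2 : MeasurableSet {q : ℝ × ℝ | q.2 * (1 - P.1) < P.2 * (1 - q.1)} :=
    measurableSet_lt (by fun_prop) (by fun_prop)
  exact measurableSet_openTriangle.inter (h1.inter h2)

theorem measurableSet_upperPart (P : ℝ × ℝ) : MeasurableSet (upperPart P) := by
  have h1 : MeasurableSet {q | Before P q} := measurable_prodMk_left (x := P) measurableSet_before
  have h2 : MeasurableSet {q : ℝ × ℝ | P.2 * (1 - q.1) < q.2 * (1 - P.1)} :=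
    measurableSet_lt (by fun_prop) (by fun_prop)
  exact measurableSet_openTriangle.inter (h1.inter h2)

/-- The probability that a random point lies in the lower part. -/
noncomputable def lowerProb (P : ℝ × ℝ) : ENNReal :=
  ENNReal.ofReal (P.2 * (1 - P.1 - P.2) / (1 - P.2))

/-- The probability that a random point lies in the upper part. -/
noncomputable def upperProb (P : ℝ × ℝ) : ENNReal := ENNReal.ofReal (1 - P.1 - P.2)

theorem restrict_lowerPart (hP : P ∈ openTriangle) : uniformTriangle.restrict (lowerPart P) =
    lowerProb P • uniformTriangle.map (lowerMap P) := by
  rw [restrict_uniformTriangle_eq (lowerMap_det_pos hP) (fun q hq => hq.1)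
    (lowerMap_mem_lowerPart_iff hP), lowerProb]
  congr 2
  have h : 1 - P.2 ≠ 0 := by linarith [hP.1, hP.2.2]
  have := foot_mul hP
  rw [eq_div_iff h]
  linear_combination -P.2 * this

theorem uniformTriangle_upperPart (hP : P ∈ openTriangle) :
    uniformTriangle (upperPart P) = upperProb P := by
  have h := restrict_uniformTriangle_eq (upperMap_det_pos hP) (R := upperPart P)
    (fun q hq => hq.1) (upperMap_mem_upperPart_iff hP)
  have h1 := congrArg (fun ν => ν Set.univ) h
  simp only [Measure.restrict_apply_univ, Measure.smul_apply] at h1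
  rw [h1, Measure.map_apply (measurable_planeMap _ _ _ _ _ _) MeasurableSet.univ, Set.preimage_univ,
    measure_univ, smul_eq_mul, mul_one, upperProb]
  congr 1
  ring

/-- The law of independent uniform points indexed by `κ`. -/
noncomputable abbrev sample (κ : Type*) [Fintype κ] : Measure (κ → ℝ × ℝ) :=
  Measure.pi fun _ => uniformTriangle

theorem ae_sample_mem (κ : Type*) [Fintype κ] : ∀ᵐ y ∂sample κ, ∀ i, y i ∈ openTriangle := by
  refine ae_all_iff.2 fun i => ?_
  exact (measurePreserving_eval (fun _ : κ => uniformTriangle) i).quasiMeasurePreserving.ae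
    ae_mem_openTriangle

theorem sample_restrict_lowerPart (κ : Type*) [Fintype κ] (hP : P ∈ openTriangle) :
    (sample κ).restrict (Set.univ.pi fun _ => lowerPart P) =
      lowerProb P ^ Fintype.card κ • (sample κ).map (fun y i => lowerMap P (y i)) := by
  rw [Measure.restrict_pi_pi]
  have hm : Measurable fun (y : κ → ℝ × ℝ) i => lowerMap P (y i) :=
    measurable_pi_lambda _ fun i => (measurable_lowerMap P).comp (measurable_pi_apply i)
  refine Measure.pi_eq fun s hs => ?_
  have hpre : (fun (y : κ → ℝ × ℝ) i => lowerMap P (y i)) ⁻¹' (Set.univ.pi s) =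
      Set.univ.pi fun i => lowerMap P ⁻¹' s i := by
    ext y
    simp
  rw [Measure.smul_apply, Measure.map_apply hm (MeasurableSet.univ_pi hs), hpre, Measure.pi_pi,
    smul_eq_mul, ← Finset.card_univ, ← Finset.prod_const, ← Finset.prod_mul_distrib]
  refine Finset.prod_congr rfl fun i _ => ?_
  rw [restrict_lowerPart hP, Measure.smul_apply,
    Measure.map_apply (measurable_lowerMap P) (hs i), smul_eq_mul]

/-- The probability that `n` random points produce `m` vertices. -/
noncomputable def countProb (n m : ℕ) : ENNReal :=
  sample (Fin n) {x | hullCount (Set.range x) = m}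

theorem prob_eq (n k : ℕ) : prob n k = (countProb n (k + 2)).toReal := rfl

theorem countProb_card (κ : Type*) [Fintype κ] (m : ℕ) :
    sample κ {x | hullCount (Set.range x) = m} = countProb (Fintype.card κ) m := by
  have f := (Fintype.equivFin κ).symm
  have h := (measurePreserving_piCongrLeft (fun _ : κ => uniformTriangle) f).measure_preimage_equiv
    {x | hullCount (Set.range x) = m}
  rw [← h, countProb]
  congr 1
  ext x
  have : Set.range (MeasurableEquiv.piCongrLeft (fun _ : κ => ℝ × ℝ) f x) = Set.range x := by
    have h2 : MeasurableEquiv.piCongrLeft (fun _ : κ => ℝ × ℝ) f x = x ∘ f.symm := by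
      funext i
      obtain ⟨j, rfl⟩ := f.surjective i
      rw [MeasurableEquiv.coe_piCongrLeft, Equiv.piCongrLeft_apply_apply]
      simp
    rw [h2, f.symm.surjective.range_comp]
  simp only [Set.mem_preimage, Set.mem_ofPred_eq, this]

theorem measurableSet_hullCount_insert (κ : Type*) [Fintype κ] (m : ℕ) :
    MeasurableSet {p : (ℝ × ℝ) × (κ → ℝ × ℝ) | hullCount (insert p.1 (Set.range p.2)) = m} := by
  have hm : Measurable fun p : (ℝ × ℝ) × (κ → ℝ × ℝ) =>
      (fun o : Option κ => o.elim p.1 p.2 : Option κ → ℝ × ℝ) := by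
    refine measurable_pi_lambda _ fun o => ?_
    cases o with
    | none => exact measurable_fst
    | some i => exact (measurable_pi_apply i).comp measurable_snd
  convert hm (measurableSet_hullCount (ι := Option κ) m) using 1
  ext p
  simp only [Set.mem_preimage, Set.mem_ofPred_eq]
  rw [show Set.range (fun o : Option κ => o.elim p.1 p.2) = insert p.1 (Set.range p.2) by
    ext q
    simp [Option.exists, eq_comm]]

theorem measurableSet_hullCount_insert_left (κ : Type*) [Fintype κ] (P : ℝ × ℝ) (m : ℕ) :
    MeasurableSet {y : κ → ℝ × ℝ | hullCount (insert P (Set.range y)) = m} :=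
  measurable_prodMk_left (x := P) (measurableSet_hullCount_insert κ m)

/-- Points that are uniform below the line through `P` and `(1,0)` become uniform in the triangle
under the inverse of `lowerMap P`, which takes away the vertex `P`. -/
theorem sample_lowerPart (κ : Type*) [Fintype κ] (hP : P ∈ openTriangle) (m : ℕ) :
    sample κ {y | (∀ i, y i ∈ lowerPart P) ∧ hullCount (insert P (Set.range y)) = m + 1} =
      lowerProb P ^ Fintype.card κ * countProb (Fintype.card κ) m := by
  have hm : Measurable fun (y : κ → ℝ × ℝ) i => lowerMap P (y i) :=
    measurable_pi_lambda _ fun i => (measurable_lowerMap P).comp (measurable_pi_apply i)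
  have hE := measurableSet_hullCount_insert_left κ P (m + 1)
  have h1 : {y : κ → ℝ × ℝ | (∀ i, y i ∈ lowerPart P) ∧
      hullCount (insert P (Set.range y)) = m + 1} =
      {y | hullCount (insert P (Set.range y)) = m + 1} ∩ Set.univ.pi fun _ => lowerPart P := by
    ext y
    simp [and_comm]
  rw [h1, ← Measure.restrict_apply hE, sample_restrict_lowerPart κ hP, Measure.smul_apply,
    smul_eq_mul, Measure.map_apply hm hE, ← countProb_card κ]
  congr 1
  refine measure_congr ?_
  filter_upwards [ae_sample_mem κ] with y hy
  refine propext ?_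
  change hullCount (insert P (Set.range fun i => lowerMap P (y i))) = m + 1 ↔
    hullCount (Set.range y) = m
  have := hullCount_insert hP (Set.finite_range y) (Set.range_subset_iff.2 hy)
    (Set.empty_subset (upperPart P))
  rw [Set.union_empty, ← Set.range_comp] at this
  rw [show (Set.range fun i => lowerMap P (y i)) = Set.range (lowerMap P ∘ y) from rfl, this]
  omega

/-- The configurations in which the points in the lower part are those indexed by `A`. -/
def splitConfig {n : ℕ} (P : ℝ × ℝ) (A : Finset (Fin n)) : Set (Fin n → ℝ × ℝ) :=
  {y | (∀ i, i ∈ A → y i ∈ lowerPart P) ∧ ∀ i, i ∉ A → y i ∈ upperPart P}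

/-- The points in the upper part do not affect the number of vertices. -/
theorem hullCount_insert_of_splitConfig (hP : P ∈ openTriangle) {n : ℕ} {A : Finset (Fin n)}
    {y : Fin n → ℝ × ℝ} (hy : y ∈ splitConfig P A) :
    hullCount (insert P (Set.range y)) =
      hullCount (insert P (Set.range fun i : {i // i ∈ A} => y i)) := by
  have key (Q : Set (ℝ × ℝ)) (hQ : Q ⊆ upperPart P) :
      hullCount (insert P ((Set.range fun i : {i // i ∈ A} => y i) ∪ Q)) =
        hullCount (lowerMap P ⁻¹' (Set.range fun i : {i // i ∈ A} => y i)) + 1 := by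
    have hbij := lowerMap_bijective hP
    have hsub : lowerMap P ⁻¹' (Set.range fun i : {i // i ∈ A} => y i) ⊆ openTriangle := by
      rintro p ⟨i, hi⟩
      rw [← lowerMap_mem_lowerPart_iff hP, ← hi]
      exact hy.1 i i.2
    have h := hullCount_insert hP ((Set.finite_range _).preimage hbij.1.injOn) hsub hQ
    rwa [Set.image_preimage_eq _ hbij.2] at h
  have h1 : Set.range y = (Set.range fun i : {i // i ∈ A} => y i) ∪ y '' {i | i ∉ A} := by
    ext q
    constructor
    · rintro ⟨i, rfl⟩
      by_cases hi : i ∈ A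
      · exact Or.inl ⟨⟨i, hi⟩, rfl⟩
      · exact Or.inr ⟨i, hi, rfl⟩
    · rintro (⟨i, rfl⟩ | ⟨i, -, rfl⟩) <;> exact ⟨_, rfl⟩
  have h2 := key (y '' {i | i ∉ A}) (by
    rintro _ ⟨i, hi, rfl⟩
    exact hy.2 i hi)
  have h3 := key ∅ (Set.empty_subset _)
  rw [← h1] at h2
  rw [Set.union_empty] at h3
  rw [h2, h3]

theorem sample_splitConfig (hP : P ∈ openTriangle) {n : ℕ} (A : Finset (Fin n)) (m : ℕ) :
    sample (Fin n) {y | y ∈ splitConfig P A ∧ hullCount (insert P (Set.range y)) = m + 1} =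
      lowerProb P ^ A.card * upperProb P ^ (n - A.card) * countProb A.card m := by
  have he := measurePreserving_piEquivPiSubtypeProd (fun _ : Fin n => uniformTriangle) (· ∈ A)
  have hpre : {y | y ∈ splitConfig P A ∧ hullCount (insert P (Set.range y)) = m + 1} =
      MeasurableEquiv.piEquivPiSubtypeProd (fun _ : Fin n => ℝ × ℝ) (· ∈ A) ⁻¹'
        ({v | (∀ i, v i ∈ lowerPart P) ∧ hullCount (insert P (Set.range v)) = m + 1} ×ˢ
          Set.univ.pi fun _ => upperPart P) := by
    ext y
    simp only [Set.mem_ofPred_eq, Set.mem_preimage, Set.mem_prod, Set.mem_univ_pi]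
    constructor
    · rintro ⟨h1, h2⟩
      refine ⟨⟨fun i => h1.1 i i.2, ?_⟩, fun i => h1.2 i i.2⟩
      rw [hullCount_insert_of_splitConfig hP h1] at h2
      exact h2
    · rintro ⟨⟨h1, h2⟩, h3⟩
      have hs : y ∈ splitConfig P A := ⟨fun i hi => h1 ⟨i, hi⟩, fun i hi => h3 ⟨i, hi⟩⟩
      refine ⟨hs, ?_⟩
      rw [hullCount_insert_of_splitConfig hP hs]
      exact h2
  rw [hpre, he.measure_preimage_equiv, Measure.prod_prod,
    @sample_lowerPart P {i // i ∈ A} (Subtype.fintype _) hP m, Measure.pi_pi,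
    Finset.prod_const, uniformTriangle_upperPart hP, Finset.card_univ, Fintype.card_subtype_compl,
    Fintype.card_fin]
  have hcard (h : Fintype {i // i ∈ A}) : @Fintype.card {i // i ∈ A} h = A.card :=
    Fintype.card_of_subtype A fun _ => Iff.rfl
  rw [hcard, hcard]
  ring

theorem ae_not_collinear (hP : P ∈ openTriangle) :
    ∀ᵐ q ∂uniformTriangle, q.2 * (1 - P.1) ≠ P.2 * (1 - q.1) := by
  refine uniformTriangle_absolutelyContinuous.ae_le ?_
  have h : 1 - P.1 ≠ 0 := by linarith [hP.2.1, hP.2.2]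
  have := volume_line_eq_zero (a := P.2) (b := 1 - P.1) (c := P.2) (Or.inr h)
  refine ae_iff.2 ?_
  convert this using 2
  ext q
  simp only [not_not, Set.mem_ofPred_eq]
  constructor <;> intro h <;> linarith

theorem ae_not_tied (hP : P ∈ openTriangle) :
    ∀ᵐ q ∂uniformTriangle, P.1 * (1 - q.2) ≠ q.1 * (1 - P.2) := by
  refine uniformTriangle_absolutelyContinuous.ae_le ?_
  have h : 1 - P.2 ≠ 0 := by linarith [hP.1, hP.2.2]
  have := volume_line_eq_zero (a := 1 - P.2) (b := P.1) (c := P.1) (Or.inl h)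
  refine ae_iff.2 ?_
  convert this using 2
  ext q
  simp only [not_not, Set.mem_ofPred_eq]
  constructor <;> intro h <;> linarith

/-- Conditionally on the first point `P` of the chain, each other point falls independently
below the line through `P` and `(1,0)`, where it is uniformly distributed, or above it. -/
theorem sample_first (hP : P ∈ openTriangle) (n m : ℕ) :
    sample (Fin n) {y | (∀ i, Before P (y i)) ∧ hullCount (insert P (Set.range y)) = m + 1} =
      ∑ j ∈ Finset.range (n + 1), (n.choose j : ENNReal) *
        (countProb j m * (lowerProb P ^ j * upperProb P ^ (n - j))) := by
  have hae : {y : Fin n → ℝ × ℝ | (∀ i, Before P (y i)) ∧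
      hullCount (insert P (Set.range y)) = m + 1} =ᵐ[sample (Fin n)]
      ⋃ A ∈ (Finset.univ : Finset (Finset (Fin n))),
        {y | y ∈ splitConfig P A ∧ hullCount (insert P (Set.range y)) = m + 1} := by
    have h1 : ∀ᵐ y ∂sample (Fin n), ∀ i, (y i).2 * (1 - P.1) ≠ P.2 * (1 - (y i).1) :=
      ae_all_iff.2 fun i => (measurePreserving_eval (fun _ : Fin n => uniformTriangle)
        i).quasiMeasurePreserving.ae (ae_not_collinear hP)
    filter_upwards [h1, ae_sample_mem (Fin n)] with y hy hyT
    refine propext ?_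
    change ((∀ i, Before P (y i)) ∧ hullCount (insert P (Set.range y)) = m + 1) ↔ y ∈ ⋃ A ∈ _, _
    simp only [Finset.mem_univ, Set.iUnion_true, Set.mem_iUnion, Set.mem_ofPred_eq,
      exists_and_right]
    refine and_congr_left fun _ => ⟨fun hB => ?_, ?_⟩
    · refine ⟨Finset.univ.filter fun i => (y i).2 * (1 - P.1) < P.2 * (1 - (y i).1),
        fun i hi => ⟨hyT i, hB i, by simpa using hi⟩, fun i hi => ⟨hyT i, hB i, ?_⟩⟩
      exact lt_of_le_of_ne (by simpa using hi) (hy i).symm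
    · rintro ⟨A, hA⟩ i
      by_cases hi : i ∈ A
      · exact (hA.1 i hi).2.1
      · exact (hA.2 i hi).2.1
  rw [measure_congr hae, measure_biUnion_finset]
  · simp only [sample_splitConfig hP]
    rw [← Finset.powerset_univ, Finset.sum_powerset_apply_card (fun j =>
      lowerProb P ^ j * upperProb P ^ (n - j) * countProb j m), Finset.card_univ, Fintype.card_fin]
    refine Finset.sum_congr rfl fun j _ => ?_
    rw [nsmul_eq_mul, mul_comm (countProb j m)]
  · rintro A - B - hAB
    refine Set.disjoint_left.2 fun y hyA hyB => hAB ?_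
    have hdis (q : ℝ × ℝ) (h1 : q ∈ lowerPart P) (h2 : q ∈ upperPart P) : False :=
      lt_asymm h1.2.2 h2.2.2
    ext i
    constructor
    · intro hi
      by_contra hi'
      exact hdis _ (hyA.1.1 i hi) (hyB.1.2 i hi')
    · intro hi
      by_contra hi'
      exact hdis _ (hyB.1.1 i hi) (hyA.1.2 i hi')
  · intro A _
    refine MeasurableSet.inter ?_ (measurableSet_hullCount_insert_left _ P _)
    have h1 : splitConfig P A = (⋂ i, ⋂ (_ : i ∈ A), (fun y => y i) ⁻¹' lowerPart P) ∩
        ⋂ i, ⋂ (_ : i ∉ A), (fun y => y i) ⁻¹' upperPart P := by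
      ext y
      simp [splitConfig]
    rw [h1]
    exact (MeasurableSet.iInter fun i => MeasurableSet.iInter fun _ =>
      measurable_pi_apply i (measurableSet_lowerPart P)).inter (MeasurableSet.iInter fun i =>
        MeasurableSet.iInter fun _ => measurable_pi_apply i (measurableSet_upperPart P))

/-! ### The recurrence for the vertex probabilities -/

/-- Almost surely no two points are collinear with `(0,1)`. -/
theorem ae_pairwise_not_tied (n : ℕ) : ∀ᵐ x ∂sample (Fin (n + 1)), ∀ i j, j ≠ i →
    (x i).1 * (1 - (x j).2) ≠ (x j).1 * (1 - (x i).2) := by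
  refine ae_all_iff.2 fun i => ?_
  have he := measurePreserving_piFinSuccAbove (fun _ : Fin (n + 1) => uniformTriangle) i
  have h : ∀ᵐ p ∂uniformTriangle.prod (sample (Fin n)), ∀ j : Fin n,
      p.1.1 * (1 - (p.2 j).2) ≠ (p.2 j).1 * (1 - p.1.2) := by
    refine ae_all_iff.2 fun j => ?_
    have hm : MeasurableSet {p : (ℝ × ℝ) × (Fin n → ℝ × ℝ) |
        p.1.1 * (1 - (p.2 j).2) = (p.2 j).1 * (1 - p.1.2)} :=
      measurableSet_eq_fun (by fun_prop) (by fun_prop)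
    refine ae_iff.2 ?_
    simp only [not_not]
    rw [Measure.measure_prod_null hm]
    filter_upwards [ae_mem_openTriangle] with P hP
    have := (measurePreserving_eval (fun _ : Fin n => uniformTriangle) j).quasiMeasurePreserving.ae
      (ae_not_tied hP)
    simpa [ae_iff] using this
  filter_upwards [he.quasiMeasurePreserving.ae h] with x hx j hj
  obtain ⟨j, rfl⟩ := Fin.exists_succAbove_eq hj
  exact hx j

/-- Integration over the position of the `i`-th point, on the event that it comes first. -/
theorem sample_inter_first (n m : ℕ) (i : Fin (n + 1)) :
    sample (Fin (n + 1)) {x | (∀ j, Before (x i) (x (i.succAbove j))) ∧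
      hullCount (Set.range x) = m} =
    ∫⁻ P, sample (Fin n) {y | (∀ j, Before P (y j)) ∧ hullCount (insert P (Set.range y)) = m}
      ∂uniformTriangle := by
  have he := measurePreserving_piFinSuccAbove (fun _ : Fin (n + 1) => uniformTriangle) i
  have hm : MeasurableSet {p : (ℝ × ℝ) × (Fin n → ℝ × ℝ) |
      (∀ j, Before p.1 (p.2 j)) ∧ hullCount (insert p.1 (Set.range p.2)) = m} := by
    refine MeasurableSet.inter ?_ (measurableSet_hullCount_insert _ m)
    have : {p : (ℝ × ℝ) × (Fin n → ℝ × ℝ) | ∀ j, Before p.1 (p.2 j)} =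
        ⋂ j, {p | Before p.1 (p.2 j)} := by
      ext p
      simp
    change MeasurableSet {p : (ℝ × ℝ) × (Fin n → ℝ × ℝ) | ∀ j, Before p.1 (p.2 j)}
    rw [this]
    exact MeasurableSet.iInter fun j => measurableSet_lt (by fun_prop) (by fun_prop)
  have hpre : {x : Fin (n + 1) → ℝ × ℝ | (∀ j, Before (x i) (x (i.succAbove j))) ∧
      hullCount (Set.range x) = m} =
      MeasurableEquiv.piFinSuccAbove (fun _ : Fin (n + 1) => ℝ × ℝ) i ⁻¹'
        {p | (∀ j, Before p.1 (p.2 j)) ∧ hullCount (insert p.1 (Set.range p.2)) = m} := by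
    ext x
    have hr : Set.range x = insert (x i) (Set.range fun j => x (i.succAbove j)) := by
      ext q
      simp only [Set.mem_range, Set.mem_insert_iff, i.exists_iff_succAbove, eq_comm (a := q)]
    change (_ ∧ _) ↔ ((∀ j, Before (x i) (x (i.succAbove j))) ∧
      hullCount (insert (x i) (Set.range fun j => x (i.succAbove j))) = m)
    rw [hr]
  rw [hpre, he.measure_preimage_equiv, Measure.prod_apply hm]
  rfl

/-- Almost surely exactly one of the points comes first. -/
theorem countProb_succ_eq_sum (n m : ℕ) : countProb (n + 1) m =
    ∑ i : Fin (n + 1), sample (Fin (n + 1)) {x | (∀ j, Before (x i) (x (i.succAbove j))) ∧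
      hullCount (Set.range x) = m} := by
  have hae : {x : Fin (n + 1) → ℝ × ℝ | hullCount (Set.range x) = m} =ᵐ[sample (Fin (n + 1))]
      ⋃ i ∈ (Finset.univ : Finset (Fin (n + 1))), {x | (∀ j, Before (x i) (x (i.succAbove j))) ∧
        hullCount (Set.range x) = m} := by
    filter_upwards [ae_pairwise_not_tied n, ae_sample_mem (Fin (n + 1))] with x hx hxT
    refine propext ?_
    change hullCount (Set.range x) = m ↔ x ∈ ⋃ i ∈ _, _
    simp only [Finset.mem_univ, Set.iUnion_true, Set.mem_iUnion, Set.mem_ofPred_eq,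
      exists_and_right, iff_and_self]
    intro _
    obtain ⟨i, hi⟩ := Finite.exists_min fun i => foot (x i)
    refine ⟨i, fun j => lt_of_le_of_ne ?_ (hx i _ (Fin.succAbove_ne i j))⟩
    have h1 := hi (i.succAbove j)
    have p1 : 0 < 1 - (x i).2 := by linarith [(hxT i).1, (hxT i).2.2]
    have p2 : 0 < 1 - (x (i.succAbove j)).2 := by
      linarith [(hxT (i.succAbove j)).1, (hxT (i.succAbove j)).2.2]
    exact (div_le_div_iff₀ p1 p2).1 h1
  rw [countProb, measure_congr hae, measure_biUnion_finset]
  · intro i _ i' _ hii'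
    refine Set.disjoint_left.2 fun x hx hx' => ?_
    obtain ⟨j, hj⟩ := Fin.exists_succAbove_eq (Ne.symm hii')
    obtain ⟨j', hj'⟩ := Fin.exists_succAbove_eq hii'
    have h1 := hx.1 j
    have h2 := hx'.1 j'
    rw [hj] at h1
    rw [hj'] at h2
    exact lt_asymm h1 h2
  · intro i _
    refine MeasurableSet.inter ?_ (measurableSet_hullCount m)
    have : {x : Fin (n + 1) → ℝ × ℝ | ∀ j, Before (x i) (x (i.succAbove j))} =
        ⋂ j, {x | Before (x i) (x (i.succAbove j))} := by
      ext x
      simp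
    change MeasurableSet {x : Fin (n + 1) → ℝ × ℝ | ∀ j, Before (x i) (x (i.succAbove j))}
    rw [this]
    exact MeasurableSet.iInter fun j => measurableSet_lt (by fun_prop) (by fun_prop)

theorem lintegral_lowerProb_mul_upperProb {n j : ℕ} (hj : j ≤ n) :
    ∫⁻ P, lowerProb P ^ j * upperProb P ^ (n - j) ∂uniformTriangle =
      ENNReal.ofReal
        (2 * (j.factorial * (n + 1 - j).factorial / ((n + 1) * (n + 2).factorial))) := by
  rw [uniformTriangle_eq, lintegral_smul_measure, ENNReal.ofReal_mul zero_le_two,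
    ← lintegral_openTriangle hj, smul_eq_mul, ENNReal.ofReal_ofNat]
  congr 1
  refine setLIntegral_congr_fun measurableSet_openTriangle fun P hP => ?_
  have h1 : 0 ≤ 1 - P.1 - P.2 := by linarith [hP.2.2]
  have h2 : 0 ≤ 1 - P.2 := by linarith [hP.1]
  have h3 : 0 ≤ P.2 * (1 - P.1 - P.2) / (1 - P.2) :=
    div_nonneg (mul_nonneg hP.2.1.le h1) h2
  simp only [lowerProb, upperProb]
  rw [← ENNReal.ofReal_pow h3, ← ENNReal.ofReal_pow h1, ← ENNReal.ofReal_mul (pow_nonneg h3 _)]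

/-- The recurrence before simplification: `n + 1` choices of the first point, `n.choose j` choices
of the `j` points below the line through it and `(1,0)`. -/
theorem countProb_succ (n m : ℕ) : countProb (n + 1) (m + 1) =
    (n + 1) * ∑ j ∈ Finset.range (n + 1), (n.choose j : ENNReal) * (countProb j m *
      ENNReal.ofReal
        (2 * (j.factorial * (n + 1 - j).factorial / ((n + 1) * (n + 2).factorial)))) := by
  rw [countProb_succ_eq_sum]
  simp only [sample_inter_first, Finset.sum_const, Finset.card_univ, Fintype.card_fin,
    nsmul_eq_mul]
  push_cast
  congr 1
  have hae : ∀ᵐ P ∂uniformTriangle, sample (Fin n)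
      {y | (∀ j, Before P (y j)) ∧ hullCount (insert P (Set.range y)) = m + 1} =
      ∑ j ∈ Finset.range (n + 1), (n.choose j : ENNReal) *
        (countProb j m * (lowerProb P ^ j * upperProb P ^ (n - j))) := by
    filter_upwards [ae_mem_openTriangle] with P hP using sample_first hP n m
  have hmeas (j : ℕ) : Measurable fun P => lowerProb P ^ j * upperProb P ^ (n - j) := by
    unfold lowerProb upperProb
    fun_prop
  rw [lintegral_congr_ae hae, lintegral_finsetSum _ fun j _ => ((hmeas j).const_mul _).const_mul _]
  refine Finset.sum_congr rfl fun j hj => ?_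
  rw [lintegral_const_mul _ ((hmeas j).const_mul _), lintegral_const_mul _ (hmeas j),
    lintegral_lowerProb_mul_upperProb (by simpa [Nat.lt_succ_iff] using hj)]

theorem prob_succ_succ (n k : ℕ) : ((n : ℝ) + 1) * (n + 2) * prob (n + 1) (k + 1) =
    2 * ∑ j ∈ Finset.range (n + 1), (((n - j : ℕ) : ℝ) + 1) * prob j k := by
  have hfin (j m : ℕ) : countProb j m ≠ ⊤ := measure_ne_top _ _
  rw [prob_eq, countProb_succ n (k + 2), ENNReal.toReal_mul, ENNReal.toReal_sum]
  · rw [show ((n : ENNReal) + 1).toReal = (n : ℝ) + 1 by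
      rw [← Nat.cast_add_one, ENNReal.toReal_natCast, Nat.cast_add_one], Finset.mul_sum,
      Finset.mul_sum, Finset.mul_sum]
    refine Finset.sum_congr rfl fun j hj => ?_
    have hj' : j ≤ n := by simpa [Nat.lt_succ_iff] using hj
    obtain ⟨d, rfl⟩ := Nat.exists_eq_add_of_le hj'
    rw [ENNReal.toReal_mul, ENNReal.toReal_mul, ENNReal.toReal_ofReal (by positivity),
      ENNReal.toReal_natCast, ← prob_eq, Nat.cast_add_choose,
      show j + d + 1 - j = d + 1 by omega, show j + d - j = d by omega, Nat.factorial_succ d,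
      Nat.factorial_succ (j + d + 1), Nat.factorial_succ (j + d)]
    have h1 : (j.factorial : ℝ) ≠ 0 := by exact_mod_cast j.factorial_ne_zero
    have h2 : (d.factorial : ℝ) ≠ 0 := by exact_mod_cast d.factorial_ne_zero
    have h3 : ((j + d).factorial : ℝ) ≠ 0 := by exact_mod_cast (j + d).factorial_ne_zero
    have h4 : (j : ℝ) + d + 1 ≠ 0 := by positivity
    have h5 : (j : ℝ) + d + 2 ≠ 0 := by positivity
    have h6 : (j : ℝ) + d + 1 + 1 ≠ 0 := by positivity
    push_cast
    field_simp
    ring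
  · intro j _
    exact ENNReal.mul_ne_top (ENNReal.natCast_ne_top _)
      (ENNReal.mul_ne_top (hfin _ _) ENNReal.ofReal_ne_top)

theorem prob_succ_zero (n : ℕ) : prob (n + 1) 0 = 0 := by
  rw [prob_eq, countProb, ENNReal.toReal_eq_zero_iff]
  left
  rw [← compl_compl {x : Fin (n + 1) → ℝ × ℝ | hullCount (Set.range x) = 0 + 2}]
  refine mem_ae_iff.1 ?_
  filter_upwards [ae_sample_mem (Fin (n + 1))] with x hx
  exact hullCount_ne_two (Set.finite_range x) (Set.range_nonempty x) (Set.range_subset_iff.2 hx)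

theorem prob_zero (k : ℕ) : prob 0 k = if k = 0 then 1 else 0 := by
  have h : hullCount ∅ = 2 := by
    have hext : (convexHull ℝ
        ({((1 : ℝ), (0 : ℝ)), ((0 : ℝ), (1 : ℝ))} : Set (ℝ × ℝ))).extremePoints ℝ =
        {((1 : ℝ), (0 : ℝ)), ((0 : ℝ), (1 : ℝ))} := by
      ext p
      rw [mem_extremePoints_convexHull_iff]
      refine ⟨fun h => h.1, fun h => ⟨h, ?_⟩⟩
      rcases h with rfl | rfl
      · simp
      · simp
    rw [hullCount, Set.union_empty, hext, Set.ncard_pair (by simp)]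
  have hs : {x : Fin 0 → ℝ × ℝ | hullCount (Set.range x) = k + 2} =
      if k = 0 then Set.univ else ∅ := by
    ext x
    rw [Set.mem_ofPred_eq, Set.range_eq_empty, h]
    split_ifs with hk
    · simp [hk]
    · simp only [Set.mem_empty_iff_false, iff_false]
      omega
  rw [prob_eq, countProb, hs]
  split_ifs <;> simp

theorem prob_eq_zero_of_lt {n k : ℕ} (h : n < k) : prob n k = 0 := by
  induction k generalizing n with
  | zero => omega
  | succ k ih =>
    cases n with
    | zero => simp [prob_zero]
    | succ n =>
      have h1 := prob_succ_succ n k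
      rw [Finset.sum_eq_zero fun j hj => by
        rw [ih (by simp at hj; omega), mul_zero], mul_zero] at h1
      exact (mul_eq_zero.1 h1).resolve_left (by positivity)

/-! ### The generating polynomials -/

/-- The conventions for `n = 0` and `n = 1` agree with the probabilistic definition, and the
constant term of the later polynomials vanishes. -/
theorem genPoly_eq (n : ℕ) : genPoly n =
    ∑ k ∈ Finset.range (n + 1), Polynomial.C ((prob n k : ℝ) : ℂ) * Polynomial.X ^ k := by
  match n with
  | 0 => simp [genPoly, prob_zero]
  | 1 =>
    have h := prob_succ_succ 0 0
    have h1 : prob 1 1 = 1 := by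
      norm_num [prob_zero] at h
      linarith
    simp [genPoly, Finset.sum_range_succ, h1, prob_succ_zero 0]
  | n + 2 =>
    rw [genPoly]
    refine Finset.sum_subset (fun k hk => ?_) fun k hk hk' => ?_
    · simp at hk ⊢
      omega
    · have : k = 0 := by
        simp at hk hk'
        omega
      rw [this, prob_succ_zero (n + 1)]
      simp

theorem coeff_genPoly (n k : ℕ) : (genPoly n).coeff k = ((prob n k : ℝ) : ℂ) := by
  rw [genPoly_eq, Polynomial.finsetSum_coeff]
  simp only [Polynomial.coeff_C_mul_X_pow]
  rw [Finset.sum_ite_eq]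
  split_ifs with h
  · rfl
  · rw [prob_eq_zero_of_lt (by simpa [Nat.lt_succ_iff] using h), Complex.ofReal_zero]

theorem genPoly_isRec : IsRec (Polynomial.X : ℂ[X]) genPoly := by
  intro n
  ext k
  have e1 : ((n : ℂ[X]) + 1) * (n + 2) = Polynomial.C (((n : ℂ) + 1) * (n + 2)) := by
    simp only [map_mul, map_add, map_natCast, map_ofNat, map_one]
  have e2 : 2 * Polynomial.X * ∑ j ∈ Finset.range (n + 1),
      (((n - j : ℕ) : ℂ[X]) + 1) * genPoly j =
      Polynomial.X * ∑ j ∈ Finset.range (n + 1),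
        Polynomial.C (2 * (((n - j : ℕ) : ℂ) + 1)) * genPoly j := by
    rw [Finset.mul_sum, Finset.mul_sum]
    refine Finset.sum_congr rfl fun j _ => ?_
    simp only [map_mul, map_add, map_natCast, map_ofNat, map_one]
    ring
  rw [e1, e2, Polynomial.coeff_C_mul, coeff_genPoly]
  cases k with
  | zero => simp [prob_succ_zero]
  | succ k =>
    rw [Polynomial.coeff_X_mul, Polynomial.finsetSum_coeff]
    simp only [Polynomial.coeff_C_mul, coeff_genPoly]
    have h := congrArg (fun x : ℝ => (x : ℂ)) (prob_succ_succ n k)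
    simp only [Finset.mul_sum] at h
    push_cast at h
    rw [h]
    exact Finset.sum_congr rfl fun j _ => by ring

theorem genPoly_eval_isRec (z : ℂ) : IsRec z fun n => (genPoly n).eval z := by
  intro n
  have := congrArg (Polynomial.eval z) (genPoly_isRec n)
  simpa [Polynomial.eval_finsetSum] using this

theorem genSeries_isFormalSolution : IsFormalSolution genSeries := by
  refine isFormalSolution_iff.2 ⟨fun n => ?_, by simp [genSeries, genPoly]⟩
  have := congrArg (Polynomial.coeToPowerSeries.ringHom (R := ℂ)) (genPoly_isRec n)
  simp only [map_mul, map_sum, map_add, map_natCast, map_ofNat, map_one] at this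
  simpa [genSeries] using this

theorem isFormalSolution_iff_eq_genSeries (H : ℂ⟦X⟧⟦X⟧) :
    IsFormalSolution H ↔ H = genSeries := by
  have : CharZero ℂ⟦X⟧ := algebraRat.charZero _
  refine ⟨fun h => ?_, fun h => h ▸ genSeries_isFormalSolution⟩
  obtain ⟨h1, h2⟩ := isFormalSolution_iff.1 h
  obtain ⟨g1, g2⟩ := isFormalSolution_iff.1 genSeries_isFormalSolution
  ext1 n
  exact congrFun (h1.unique g1 (h2.trans g2.symm)) n

end ConvexChain

theorem theorem2 :
    -- the generating function is the unique solution in the ring of formal power series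
    (∀ H : ℂ⟦X⟧⟦X⟧, ConvexChain.IsFormalSolution H ↔ H = ConvexChain.genSeries) ∧
    -- it converges for `|u| < 1`, with the explicit function as its sum
    (∀ z u : ℂ, ‖u‖ < 1 →
      HasSum (fun n : ℕ => (ConvexChain.genPoly n).eval z * u ^ n)
        (ConvexChain.closedForm u z)) ∧
    -- the explicit function is the unique holomorphic solution around `u = 0`
    (∀ z : ℂ,
      ConvexChain.IsSolution z (Metric.ball 0 1) (fun u => ConvexChain.closedForm u z) ∧
      ∀ (r : ℝ) (f : ℂ → ℂ), 0 < r → r ≤ 1 → ConvexChain.IsSolution z (Metric.ball 0 r) f →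
        Set.EqOn f (fun u => ConvexChain.closedForm u z) (Metric.ball 0 r)) ∧
    -- it has a unique jointly analytic extension, which still solves the equation
    (∃ Φ : ℂ × ℂ → ℂ,
      AnalyticOnNhd ℂ Φ (ConvexChain.slitU ×ˢ ConvexChain.slitZ) ∧
      (∀ u z : ℂ, ‖u‖ < 1 → z ∈ ConvexChain.slitZ → Φ (u, z) = ConvexChain.closedForm u z) ∧
      (∀ z ∈ ConvexChain.slitZ,
        ConvexChain.IsSolution z ConvexChain.slitU (fun u => Φ (u, z))) ∧
      ∀ Ψ : ℂ × ℂ → ℂ,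
        AnalyticOnNhd ℂ Ψ (ConvexChain.slitU ×ˢ ConvexChain.slitZ) →
        (∀ u z : ℂ, ‖u‖ < 1 → z ∈ ConvexChain.slitZ →
          Ψ (u, z) = ConvexChain.closedForm u z) →
        Set.EqOn Ψ Φ (ConvexChain.slitU ×ˢ ConvexChain.slitZ)) := by
  refine ⟨ConvexChain.isFormalSolution_iff_eq_genSeries,
    fun z u hu => ConvexChain.hasSum_closedForm (ConvexChain.genPoly_eval_isRec z)
      (by simp [ConvexChain.genPoly]) hu,
    fun z => ⟨ConvexChain.closedForm_isSolution z, fun r f hr hr1 h =>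
      h.eqOn_closedForm hr hr1⟩,
    ConvexChain.extension,
    ConvexChain.analyticOnNhd_extension.mono (Set.prod_mono le_rfl (Set.subset_univ _)),
    fun u z hu _ => ConvexChain.extension_eq_closedForm hu z,
    fun z _ => ConvexChain.isSolution_extension z,
    fun Ψ hΨ h => ConvexChain.extension_unique hΨ h⟩
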